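/- Let $\mathcal H$ be a separable Hilbert space with orthonormal (Fock) basis $\{|n\rangle\}_{n=0}^\infty$ and number operator $\hat n=\sum_n n|n\rangle\langle n|$, and let $\mathfrak T(\mathcal H)$ be the space of trace-class operators on $\mathcal H$, with trace norm $\|T\|_1=\mathrm{Tr}\sqrt{T^\dagger T}$. For $E>0$ let $\mathfrak S_E(\mathcal H)$ be the set of density operators $\rho$ on $\mathcal H$ with $\mathrm{Tr}(\hat n\rho)\le E$. For a Hermitian-preserving linear map $\Phi:\mathfrak T(\mathcal H)\to\mathfrak T(\mathcal H)$ the energy-constrained diamond norm is $$\|\Phi\|_\diamond^E=\sup\bigl\{\|(\mathrm{Id}_R\otimes\Phi)(\rho)\|_1 : \rho \text{ a density operator on } \mathcal H_R\otimes\mathcal H,\ \mathrm{Tr}_R\,\rho\in\mathfrak S_E(\mathcal H)\bigr\}\in[0,\infty],$$ where $\mathcal H_R\cong\mathcal H$ and the trace norm is taken to be $\infty$ if $(\mathrm{Id}_R\otimes\Phi)(\rho)$ is not a trace-class operator. Let $E_1,E_2>0$ and $0<\epsilon\le 1$. Let $\Psi,\tilde\Psi:\mathfrak T(\mathcal H)\to\mathfrak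 T(\mathcal H)$ be two completely positive trace-preserving linear maps, both mapping $\mathfrak S_{E_1}(\mathcal H)$ into $\mathfrak S_{E_2}(\mathcal H)$, such that $\|\Psi-\tilde\Psi\|_\diamond^{E_1}\le 2\epsilon$. Then, for every Hermitian-preserving linear map $\Phi:\mathfrak T(\mathcal H)\to\mathfrak T(\mathcal H)$, $$\|\Phi\circ(\Psi-\tilde\Psi)\|_\diamond^{E_1}\le 10\,\epsilon\,\|\Phi\|_\diamond^{E_2/\epsilon^2}.$$ -/

import Mathlib

open scoped ENNReal TensorProduct InnerProductSpace

noncomputable section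

namespace ECDiamond

/-! ### Trace norm and trace-class operators -/

section TraceClass

variable {H : Type*} [NormedAddCommGroup H] [InnerProductSpace ℂ H] [CompleteSpace H]
variable {K : Type*} [NormedAddCommGroup K] [InnerProductSpace ℂ K] [CompleteSpace K]

/-- Index set of the orthonormal basis `onb H`. -/
def onbIndex (H : Type*) [NormedAddCommGroup H] [InnerProductSpace ℂ H] [CompleteSpace H] : Set H :=
  (exists_hilbertBasis ℂ H).choose

/-- Some orthonormal basis of `H`, used to write down traces; traces do not depend on it. -/
def onb (H : Type*) [NormedAddCommGroup H] [InnerProductSpace ℂ H] [CompleteSpace H] :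
    HilbertBasis (onbIndex H) ℂ H :=
  (exists_hilbertBasis ℂ H).choose_spec.choose

/-- The trace norm `‖T‖₁ = Tr √(T† T) = ∑ᵢ ⟨eᵢ, |T| eᵢ⟩ ∈ [0, ∞]` of a bounded operator. -/
def traceNorm (T : H →L[ℂ] H) : ℝ≥0∞ :=
  ∑' i, ENNReal.ofReal (RCLike.re ⟪onb H i, CFC.abs T (onb H i)⟫_ℂ)

/-- The trace `Tr T = ∑ᵢ ⟨eᵢ, T eᵢ⟩` of a trace-class operator. -/
def trace (T : H →L[ℂ] H) : ℂ :=
  ∑' i, ⟪onb H i, T (onb H i)⟫_ℂ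

theorem enorm_sq_eq_tsum {H : Type*} [NormedAddCommGroup H] [InnerProductSpace ℂ H] {ι : Type*}
    (e : HilbertBasis ι ℂ H) (x : H) :
    ‖x‖ₑ ^ 2 = ∑' i, ‖⟪e i, x⟫_ℂ‖ₑ ^ 2 := by
  have h := e.hasSum_inner_mul_inner x x
  have h2 : HasSum (fun i => ‖⟪e i, x⟫_ℂ‖ ^ 2) (‖x‖ ^ 2) := by
    have h3 := Complex.hasSum_re h
    have hx : (⟪x, x⟫_ℂ).re = ‖x‖ ^ 2 := by
      have := inner_self_eq_norm_sq (𝕜 := ℂ) x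
      simpa using this
    rw [hx] at h3
    refine h3.congr_fun fun i => ?_
    rw [← inner_conj_symm x (e i), mul_comm, Complex.mul_conj, Complex.ofReal_re,
      Complex.normSq_eq_norm_sq]
  have e1 : ∀ z : ℝ, 0 ≤ z → ENNReal.ofReal (z ^ 2) = ENNReal.ofReal z ^ 2 := fun z hz =>
    ENNReal.ofReal_pow hz 2
  rw [← ofReal_norm, ← e1 _ (norm_nonneg _), ← h2.tsum_eq,
    ENNReal.ofReal_tsum_of_nonneg (fun i => by positivity) h2.summable]
  refine tsum_congr fun i => ?_
  rw [← ofReal_norm, ← e1 _ (norm_nonneg _)]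

theorem tsum_enorm_sq_comm {ι κ : Type*} (e : HilbertBasis ι ℂ H) (f : HilbertBasis κ ℂ K)
    (B : H →L[ℂ] K) :
    ∑' i, ‖B (e i)‖ₑ ^ 2 = ∑' j, ‖(ContinuousLinearMap.adjoint B) (f j)‖ₑ ^ 2 := by
  simp_rw [enorm_sq_eq_tsum f (B _), enorm_sq_eq_tsum e (ContinuousLinearMap.adjoint B _)]
  rw [ENNReal.tsum_comm]
  refine tsum_congr fun j => tsum_congr fun i => ?_
  rw [ContinuousLinearMap.adjoint_inner_right, ← inner_conj_symm, ← ofReal_norm,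
    RCLike.norm_conj, ofReal_norm]

theorem tsum_enorm_sq_comp_le {ι : Type*} (e : HilbertBasis ι ℂ H) (S : K →L[ℂ] K)
    (hS : IsSelfAdjoint S) (D : H →L[ℂ] K) :
    ∑' i, ‖S (D (e i))‖ₑ ^ 2 ≤ ‖D‖ₑ ^ 2 * ∑' j, ‖S (onb K j)‖ₑ ^ 2 := by
  have h := tsum_enorm_sq_comm e (onb K) (S ∘L D)
  simp only [ContinuousLinearMap.comp_apply] at h
  rw [h, ← ENNReal.tsum_mul_left]
  refine ENNReal.tsum_le_tsum fun j => ?_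
  rw [ContinuousLinearMap.adjoint_comp, ContinuousLinearMap.comp_apply, hS.adjoint_eq, ← mul_pow]
  gcongr
  refine (ContinuousLinearMap.le_opENorm _ _).trans_eq ?_
  congr 1
  rw [← ofReal_norm, ← ofReal_norm, LinearIsometryEquiv.norm_map]

theorem traceNorm_eq_tsum_sqrt (T : H →L[ℂ] H) :
    traceNorm T = ∑' i, ‖CFC.sqrt (CFC.abs T) (onb H i)‖ₑ ^ 2 := by
  refine tsum_congr fun i => ?_
  have hS : IsSelfAdjoint (CFC.sqrt (CFC.abs T)) := (CFC.sqrt_nonneg _).isSelfAdjoint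
  conv_lhs => rw [← CFC.sqrt_mul_sqrt_self (CFC.abs T) (CFC.abs_nonneg T)]
  rw [mul_apply_eq_comp, ← ContinuousLinearMap.adjoint_inner_left, hS.adjoint_eq,
    inner_self_eq_norm_sq, ENNReal.ofReal_pow (norm_nonneg _), ofReal_norm]

theorem exists_polar (A : H →L[ℂ] H) :
    ∃ U : H →L[ℂ] H, ‖U‖ ≤ 1 ∧ U * CFC.abs A = A ∧ star U * A = CFC.abs A := by
  have hP : IsSelfAdjoint (CFC.abs A) := (CFC.abs_nonneg A).isSelfAdjoint
  have hnorm : ∀ x, ‖A x‖ = ‖CFC.abs A x‖ := by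
    intro x
    have h := congrArg (fun B : H →L[ℂ] H => RCLike.re ⟪B x, x⟫_ℂ) (CFC.abs_mul_abs A)
    simp only [mul_apply_eq_comp, ContinuousLinearMap.star_eq_adjoint,
      ContinuousLinearMap.adjoint_inner_left] at h
    rw [← ContinuousLinearMap.adjoint_inner_right, hP.adjoint_eq,
      inner_self_eq_norm_sq, inner_self_eq_norm_sq] at h
    exact ((sq_eq_sq₀ (norm_nonneg _) (norm_nonneg _)).1 h).symm
  let M : Submodule ℂ H := (CFC.abs A).range.topologicalClosure
  let e : H →ₗ[ℂ] M := (CFC.abs A).toLinearMap.codRestrict M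
    (fun x => Submodule.le_topologicalClosure _ (LinearMap.mem_range_self _ x))
  have he : DenseRange e := by
    intro y
    rw [Metric.mem_closure_iff]
    intro r hr
    have hy : (y : H) ∈ closure (Set.range (CFC.abs A : H →L[ℂ] H)) := y.2
    obtain ⟨_, ⟨x, rfl⟩, hx⟩ := Metric.mem_closure_iff.1 hy r hr
    exact ⟨e x, ⟨x, rfl⟩, hx⟩
  have hb : ∀ x, ‖A.toLinearMap x‖ ≤ 1 * ‖e x‖ := fun x => by
    rw [one_mul]; exact (hnorm x).le
  have : CompleteSpace M := (Submodule.isClosed_topologicalClosure _).completeSpace_coe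
  let U : H →L[ℂ] H := (A.toLinearMap.extendOfNorm e) ∘L M.orthogonalProjectionOnto
  have hU : ‖U‖ ≤ 1 := by
    refine (ContinuousLinearMap.opNorm_comp_le _ _).trans ?_
    exact mul_le_one₀ (LinearMap.opNorm_extendOfNorm_le he zero_le_one hb) (norm_nonneg _)
      (Submodule.orthogonalProjectionOnto_norm_le _)
  have hUA : ∀ x, U (CFC.abs A x) = A x := by
    intro x
    have h1 : M.orthogonalProjectionOnto (CFC.abs A x) = e x :=
      Submodule.orthogonalProjectionOnto_mem_subspace_eq_self (K := M) (e x)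
    change A.toLinearMap.extendOfNorm e (M.orthogonalProjectionOnto (CFC.abs A x)) = A x
    rw [h1, LinearMap.extendOfNorm_eq he ⟨1, hb⟩]
    rfl
  refine ⟨U, hU, ContinuousLinearMap.ext hUA, ContinuousLinearMap.ext fun x => ?_⟩
  rw [mul_apply_eq_comp, ContinuousLinearMap.star_eq_adjoint, ← hUA x]
  set z := CFC.abs A x with hz
  have hn : ‖U z‖ = ‖z‖ := by rw [hUA x, hnorm x]
  have h1 : ‖ContinuousLinearMap.adjoint U (U z)‖ ≤ ‖z‖ := by
    refine (ContinuousLinearMap.le_opNorm _ _).trans ?_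
    rw [LinearIsometryEquiv.norm_map, hn]
    exact mul_le_of_le_one_left (norm_nonneg _) hU
  have h2 := norm_sub_sq (𝕜 := ℂ) (ContinuousLinearMap.adjoint U (U z)) z
  rw [ContinuousLinearMap.adjoint_inner_left, inner_self_eq_norm_sq, hn] at h2
  have h3 : ‖ContinuousLinearMap.adjoint U (U z) - z‖ ^ 2 ≤ 0 := by
    have := pow_le_pow_left₀ (norm_nonneg _) h1 2
    linarith
  have h4 : ‖ContinuousLinearMap.adjoint U (U z) - z‖ = 0 := by
    have := sq_nonneg ‖ContinuousLinearMap.adjoint U (U z) - z‖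
    exact pow_eq_zero_iff (two_ne_zero) |>.1 (le_antisymm h3 this)
  exact sub_eq_zero.1 (norm_eq_zero.1 h4)

theorem two_mul_tsum_enorm_inner_le {ι : Type*} (e : HilbertBasis ι ℂ H) (T : K →L[ℂ] K)
    (C D : H →L[ℂ] K) :
    2 * ∑' i, ‖⟪C (e i), T (D (e i))⟫_ℂ‖ₑ ≤ (‖C‖ₑ ^ 2 + ‖D‖ₑ ^ 2) * traceNorm T := by
  obtain ⟨U, hU, hUT, -⟩ := exists_polar T
  set S := CFC.sqrt (CFC.abs T) with hSdef
  have hS : IsSelfAdjoint S := (CFC.sqrt_nonneg _).isSelfAdjoint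
  have hSS : S * S = CFC.abs T := CFC.sqrt_mul_sqrt_self (CFC.abs T) (CFC.abs_nonneg T)
  let C' : H →L[ℂ] K := ContinuousLinearMap.adjoint U ∘L C
  have hC' : ‖C'‖ₑ ≤ ‖C‖ₑ := by
    rw [← ofReal_norm, ← ofReal_norm]
    refine ENNReal.ofReal_le_ofReal ((ContinuousLinearMap.opNorm_comp_le _ _).trans ?_)
    rw [LinearIsometryEquiv.norm_map]
    exact mul_le_of_le_one_left (norm_nonneg _) hU
  have hterm : ∀ i, 2 * ‖⟪C (e i), T (D (e i))⟫_ℂ‖ₑ ≤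
      ‖S (C' (e i))‖ₑ ^ 2 + ‖S (D (e i))‖ₑ ^ 2 := by
    intro i
    have h1 : ⟪C (e i), T (D (e i))⟫_ℂ = ⟪S (C' (e i)), S (D (e i))⟫_ℂ := by
      conv_lhs => rw [← hUT, ← hSS]
      simp only [mul_apply_eq_comp, C', ContinuousLinearMap.comp_apply]
      rw [← ContinuousLinearMap.adjoint_inner_left, ← ContinuousLinearMap.adjoint_inner_left,
        hS.adjoint_eq]
    rw [h1, ← ofReal_norm, ← ofReal_norm, ← ofReal_norm, ← ENNReal.ofReal_pow (norm_nonneg _),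
      ← ENNReal.ofReal_pow (norm_nonneg _), ← ENNReal.ofReal_add (by positivity) (by positivity),
      show (2 : ℝ≥0∞) = ENNReal.ofReal 2 by simp, ← ENNReal.ofReal_mul (by positivity)]
    refine ENNReal.ofReal_le_ofReal ?_
    have := norm_inner_le_norm (𝕜 := ℂ) (S (C' (e i))) (S (D (e i)))
    nlinarith [two_mul_le_add_sq ‖S (C' (e i))‖ ‖S (D (e i))‖]
  rw [← ENNReal.tsum_mul_left]
  refine (ENNReal.tsum_le_tsum hterm).trans ?_
  rw [ENNReal.tsum_add, add_mul, traceNorm_eq_tsum_sqrt]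
  refine add_le_add ((tsum_enorm_sq_comp_le e S hS C').trans ?_) (tsum_enorm_sq_comp_le e S hS D)
  gcongr

theorem traceNorm_le_tsum (T : H →L[ℂ] H) (U : H →L[ℂ] H) (hU : star U * T = CFC.abs T) :
    traceNorm T ≤ ∑' i, ‖⟪U (onb H i), T (onb H i)⟫_ℂ‖ₑ := by
  refine ENNReal.tsum_le_tsum fun i => ?_
  rw [← hU, mul_apply_eq_comp, ContinuousLinearMap.star_eq_adjoint,
    ContinuousLinearMap.adjoint_inner_right, ← ofReal_norm]
  exact ENNReal.ofReal_le_ofReal (RCLike.re_le_norm _)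

theorem traceNorm_add_le (S T : H →L[ℂ] H) : traceNorm (S + T) ≤ traceNorm S + traceNorm T := by
  obtain ⟨U, hU, -, h⟩ := exists_polar (S + T)
  have key : ∀ A : H →L[ℂ] H, ∑' i, ‖⟪U (onb H i), A (onb H i)⟫_ℂ‖ₑ ≤ traceNorm A := by
    intro A
    have h1 := two_mul_tsum_enorm_inner_le (onb H) A U (ContinuousLinearMap.id ℂ H)
    have h2 : ∀ B : H →L[ℂ] H, ‖B‖ ≤ 1 → ‖B‖ₑ ^ 2 ≤ 1 := fun B hB => by
      refine pow_le_one₀ (by positivity) ?_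
      rw [← ofReal_norm]
      exact ENNReal.ofReal_le_one.2 hB
    have h3 : 2 * ∑' i, ‖⟪U (onb H i), A (onb H i)⟫_ℂ‖ₑ ≤ 2 * traceNorm A := by
      refine h1.trans ?_
      gcongr
      exact (add_le_add (h2 _ hU) (h2 _ ContinuousLinearMap.norm_id_le)).trans_eq one_add_one_eq_two
    exact (ENNReal.mul_le_mul_iff_right two_ne_zero ENNReal.ofNat_ne_top).1 h3
  refine (traceNorm_le_tsum _ U h).trans (le_trans ?_ (add_le_add (key S) (key T)))
  rw [← ENNReal.tsum_add]
  refine ENNReal.tsum_le_tsum fun i => ?_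
  rw [add_apply, inner_add_right]
  exact enorm_add_le _ _

theorem traceNorm_smul (c : ℂ) (T : H →L[ℂ] H) : traceNorm (c • T) = ‖c‖ₑ * traceNorm T := by
  rw [traceNorm, traceNorm, ← ENNReal.tsum_mul_left]
  refine tsum_congr fun i => ?_
  rw [CFC.abs_smul, ← ofReal_norm, ← ENNReal.ofReal_mul (norm_nonneg _),
    smul_apply, inner_smul_right_eq_smul, RCLike.smul_re]

theorem traceNorm_conj_lt_top (T : K →L[ℂ] K) (hT : traceNorm T < ∞) (V W : H →L[ℂ] K) :
    traceNorm (ContinuousLinearMap.adjoint V ∘L T ∘L W) < ∞ := by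
  obtain ⟨U, -, -, h⟩ := exists_polar (ContinuousLinearMap.adjoint V ∘L T ∘L W)
  refine (traceNorm_le_tsum _ U h).trans_lt ?_
  have h1 := two_mul_tsum_enorm_inner_le (onb H) T (V ∘L U) W
  simp only [ContinuousLinearMap.comp_apply] at h1
  simp only [ContinuousLinearMap.comp_apply, ContinuousLinearMap.adjoint_inner_right]
  refine lt_of_le_of_lt (le_trans (le_mul_of_one_le_left (by positivity) one_le_two) h1) ?_
  exact ENNReal.mul_lt_top (ENNReal.add_lt_top.2
    ⟨ENNReal.pow_lt_top enorm_lt_top, ENNReal.pow_lt_top enorm_lt_top⟩) hT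

variable (H) in
/-- The space `𝔗(H)` of trace-class operators on `H`. -/
def TraceClass : Submodule ℂ (H →L[ℂ] H) where
  carrier := {T | traceNorm T < ∞}
  zero_mem' := by simp [traceNorm]
  add_mem' {S T} hS hT := (traceNorm_add_le S T).trans_lt (ENNReal.add_lt_top.2 ⟨hS, hT⟩)
  smul_mem' c T hT := by
    simpa only [Set.mem_ofPred_eq, traceNorm_smul] using ENNReal.mul_lt_top enorm_lt_top hT

end TraceClass

/-! ### Composite systems -/

/-- The Hilbert-space tensor product `R ⊗ H`. -/
abbrev HTensor (R H : Type*) [NormedAddCommGroup R] [InnerProductSpace ℂ R]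
    [NormedAddCommGroup H] [InnerProductSpace ℂ H] : Type _ :=
  UniformSpace.Completion (R ⊗[ℂ] H)

section Composite

variable {R : Type*} [NormedAddCommGroup R] [InnerProductSpace ℂ R] [CompleteSpace R]
variable {H : Type*} [NormedAddCommGroup H] [InnerProductSpace ℂ H] [CompleteSpace H]

/-- The operator `|f⟩ ⊗ I : H → R ⊗ H`, `x ↦ f ⊗ x`. -/
def ketTensor (f : R) : H →L[ℂ] HTensor R H :=
  UniformSpace.Completion.toComplL ∘L TensorProduct.mkL ℂ R H f

/-- The block `(⟨f| ⊗ I) X (|g⟩ ⊗ I)`, an operator on `H`, of an operator `X` on `R ⊗ H`. -/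
def block (X : HTensor R H →L[ℂ] HTensor R H) (f g : R) : H →L[ℂ] H :=
  ContinuousLinearMap.adjoint (ketTensor f) ∘L X ∘L ketTensor g

/-- The blocks of a trace-class operator, as trace-class operators. -/
def blockTC (X : TraceClass (HTensor R H)) (f g : R) : TraceClass H :=
  ⟨block X.1 f g, traceNorm_conj_lt_top X.1 X.2 _ _⟩

/-- The partial trace over `R`: `Tr_R X = ∑ᵢ (⟨eᵢ| ⊗ I) X (|eᵢ⟩ ⊗ I)`. -/
def partialTrace (X : HTensor R H →L[ℂ] HTensor R H) : H →L[ℂ] H :=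
  ∑' i, block X (onb R i) (onb R i)

/-- `Y = (Id_R ⊗ Φ)(X)`: the operator `Y` on `R ⊗ H` has the blocks
`(⟨f| ⊗ I) Y (|g⟩ ⊗ I) = Φ ((⟨f| ⊗ I) X (|g⟩ ⊗ I))`, which determine it. -/
def IsIdTensor (Φ : TraceClass H →ₗ[ℂ] TraceClass H) (X : TraceClass (HTensor R H))
    (Y : HTensor R H →L[ℂ] HTensor R H) : Prop :=
  ∀ f g : R, block Y f g = (Φ (blockTC X f g) : H →L[ℂ] H)

/-- The trace norm `‖(Id_R ⊗ Φ)(X)‖₁`; it is `∞` if `(Id_R ⊗ Φ)(X)` is not trace class, in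
particular if it does not exist as a bounded operator. -/
def idTensorTraceNorm (Φ : TraceClass H →ₗ[ℂ] TraceClass H) (X : TraceClass (HTensor R H)) :
    ℝ≥0∞ :=
  ⨅ (Y : HTensor R H →L[ℂ] HTensor R H) (_ : IsIdTensor Φ X Y), traceNorm Y

end Composite

/-! ### States, channels and the energy-constrained diamond norm -/

section Channels

variable {H : Type*} [NormedAddCommGroup H] [InnerProductSpace ℂ H] [CompleteSpace H]

/-- Density operators: positive trace-class operators of trace one. -/
def IsDensity (ρ : H →L[ℂ] H) : Prop :=
  ρ.IsPositive ∧ ρ ∈ TraceClass H ∧ trace ρ = 1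

/-- The mean photon number `Tr(n̂ ρ) = ∑ₙ n ⟨n|ρ|n⟩ ∈ [0, ∞]` of a positive operator `ρ`, where
`n̂ = ∑ₙ n |n⟩⟨n|` is the number operator of the Fock basis `b`. -/
def energy (b : HilbertBasis ℕ ℂ H) (ρ : H →L[ℂ] H) : ℝ≥0∞ :=
  ∑' n : ℕ, (n : ℝ≥0∞) * ENNReal.ofReal (RCLike.re ⟪b n, ρ (b n)⟫_ℂ)

/-- The set `𝔖_E(H)` of density operators of energy at most `E`. -/
def energyStates (b : HilbertBasis ℕ ℂ H) (E : ℝ) : Set (H →L[ℂ] H) :=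
  {ρ | IsDensity ρ ∧ energy b ρ ≤ ENNReal.ofReal E}

def IsHermitianPreserving (Φ : TraceClass H →ₗ[ℂ] TraceClass H) : Prop :=
  ∀ T : TraceClass H, IsSelfAdjoint (T : H →L[ℂ] H) → IsSelfAdjoint (Φ T : H →L[ℂ] H)

open scoped ComplexOrder in
/-- Complete positivity: for every `n`, `Id ⊗ Φ` maps positive operators on `ℂⁿ ⊗ H`, written as
`n × n` block matrices of trace-class operators, to positive operators. -/
def IsCompletelyPositive (Φ : TraceClass H →ₗ[ℂ] TraceClass H) : Prop :=
  ∀ (n : ℕ) (T : Fin n → Fin n → TraceClass H),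
    (∀ x : Fin n → H, 0 ≤ ∑ i, ∑ j, ⟪x i, (T i j : H →L[ℂ] H) (x j)⟫_ℂ) →
      ∀ x : Fin n → H, 0 ≤ ∑ i, ∑ j, ⟪x i, (Φ (T i j) : H →L[ℂ] H) (x j)⟫_ℂ

def IsTracePreserving (Φ : TraceClass H →ₗ[ℂ] TraceClass H) : Prop :=
  ∀ T : TraceClass H, trace (Φ T : H →L[ℂ] H) = trace (T : H →L[ℂ] H)

/-- Completely positive trace-preserving maps. -/
def IsCPTP (Φ : TraceClass H →ₗ[ℂ] TraceClass H) : Prop :=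
  IsCompletelyPositive Φ ∧ IsTracePreserving Φ

/-- `Φ` maps `𝔖_{E₁}(H)` into `𝔖_{E₂}(H)`. -/
def MapsEnergyStates (b : HilbertBasis ℕ ℂ H) (E₁ E₂ : ℝ)
    (Φ : TraceClass H →ₗ[ℂ] TraceClass H) : Prop :=
  ∀ ρ : TraceClass H, (ρ : H →L[ℂ] H) ∈ energyStates b E₁ → (Φ ρ : H →L[ℂ] H) ∈ energyStates b E₂

/-- The energy-constrained diamond norm `‖Φ‖_⋄^E ∈ [0, ∞]`: the supremum of `‖(Id_R ⊗ Φ)(ρ)‖₁` over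
the density operators `ρ` on `R ⊗ H` with `Tr_R ρ ∈ 𝔖_E(H)`, where `R` is a copy of `H`. -/
def ecDiamondNorm (b : HilbertBasis ℕ ℂ H) (E : ℝ) (Φ : TraceClass H →ₗ[ℂ] TraceClass H) : ℝ≥0∞ :=
  ⨆ (ρ : TraceClass (HTensor H H)) (_ : IsDensity (ρ : HTensor H H →L[ℂ] HTensor H H))
    (_ : partialTrace (ρ : HTensor H H →L[ℂ] HTensor H H) ∈ energyStates b E),
    idTensorTraceNorm Φ ρ

end Channels

end ECDiamond

end

open scoped ENNReal TensorProduct InnerProductSpace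

noncomputable section

namespace ECDiamond

/-! Write M = E₂/ε² and N for the norm of `Φ` at energy M. For an admissible ρ the outputs X = (Id ⊗
Ψ)(ρ) and Y = (Id ⊗ Ψt)(ρ) are states of energy at most E₂ with ‖X - Y‖₁ ≤ 2ε. The Jordan parts B, C
of X - Y have small trace but no energy bound that N could use, so energies above M are cut off
first. Let P = I ⊗ 1_{n̂ ≤ M} and Q = 1 - P. Then PBP and PCP carry energy at most M per unit of
trace, and P(X - Y)P = PBP - PCP costs at most ‖X - Y‖₁ N ≤ 2εN.

It remains to bound X - PXP = (PXQ + QXP) + QXQ by 4εN, and likewise for Y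
(`IsCutoff.idTensorTraceNorm_sub_conjTC_le`). The cross terms are half the difference of the
compressions of X by √ε P ± Q/√ε (`sub_conjTC_eq`). These are positive, of trace at most 2ε because
Markov's inequality gives Tr QX ≤ ε², and of energy at most E₂/ε = εM. A positive operator of trace
at most 2τ and energy at most τM costs at most 2τN, since too small a trace can be filled up with
vacuum (`idTensorTraceNorm_le_ofReal_mul`). Hence the cross terms cost 2εN, QXQ costs 2ε²N, and 2ε +
2ε² ≤ 4ε. Altogether 2 + 4 + 4 = 10.

The other half of the work is to show that the outputs exist. Complete positivity speaks of finite
block matrices only and no continuity of Ψ is assumed, so (Id ⊗ Ψ)(ρ) is built from a bounded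
positive form on the algebraic tensor product (`IsCPTP.exists_idTensor`), and its energy is
controlled through finite partial sums of blocks (`IsCPTP.exists_output`). -/

theorem coe_re_inner_of_isPositive {H : Type*} [NormedAddCommGroup H] [InnerProductSpace ℂ H]
    {A : H →L[ℂ] H} (hA : A.IsPositive) (x : H) :
    ((RCLike.re ⟪x, A x⟫_ℂ : ℝ) : ℂ) = ⟪x, A x⟫_ℂ := by
  have h : ⟪A x, x⟫_ℂ = ⟪x, A x⟫_ℂ := hA.inner_left_eq_inner_right x x
  rw [← h]
  exact ((ContinuousLinearMap.isPositive_iff_complex A).1 hA x).1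

/-! ### Traces of positive operators -/

section PositiveOperators

variable {H : Type*} [NormedAddCommGroup H] [InnerProductSpace ℂ H] [CompleteSpace H]

theorem inner_self_eq_enorm_sqrt_sq {A : H →L[ℂ] H} (hA : A.IsPositive) (x : H) :
    ENNReal.ofReal (RCLike.re ⟪x, A x⟫_ℂ) = ‖CFC.sqrt A x‖ₑ ^ 2 := by
  have hA' : 0 ≤ A := (ContinuousLinearMap.nonneg_iff_isPositive A).2 hA
  have hS : IsSelfAdjoint (CFC.sqrt A) := (CFC.sqrt_nonneg _).isSelfAdjoint
  conv_lhs => rw [← CFC.sqrt_mul_sqrt_self A hA']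
  rw [mul_apply_eq_comp, ← ContinuousLinearMap.adjoint_inner_left, hS.adjoint_eq,
    inner_self_eq_norm_sq, ENNReal.ofReal_pow (norm_nonneg _), ofReal_norm]

/-- Basis independence: with ⟨x, A x⟩ = ‖√A x‖², the sum is the squared Hilbert–Schmidt norm of √A,
and Parseval's identity moves it from one basis to another. -/
theorem traceNorm_eq_tsum {ι : Type*} (e : HilbertBasis ι ℂ H) {A : H →L[ℂ] H}
    (hA : A.IsPositive) :
    traceNorm A = ∑' i, ENNReal.ofReal (RCLike.re ⟪e i, A (e i)⟫_ℂ) := by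
  have hA' : 0 ≤ A := (ContinuousLinearMap.nonneg_iff_isPositive A).2 hA
  have hS : IsSelfAdjoint (CFC.sqrt A) := (CFC.sqrt_nonneg _).isSelfAdjoint
  rw [traceNorm, CFC.abs_of_nonneg A hA']
  simp_rw [inner_self_eq_enorm_sqrt_sq hA]
  have h := tsum_enorm_sq_comm (onb H) e (CFC.sqrt A)
  rwa [hS.adjoint_eq] at h

/-- The same double sum, with Bessel's inequality in place of Parseval's identity. -/
theorem tsum_inner_le_traceNorm {ι : Type*} {v : ι → H} (hv : Orthonormal ℂ v)
    {A : H →L[ℂ] H} (hA : A.IsPositive) :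
    ∑' i, ENNReal.ofReal (RCLike.re ⟪v i, A (v i)⟫_ℂ) ≤ traceNorm A := by
  have hS : IsSelfAdjoint (CFC.sqrt A) := (CFC.sqrt_nonneg _).isSelfAdjoint
  rw [traceNorm_eq_tsum (onb H) hA]
  simp_rw [inner_self_eq_enorm_sqrt_sq hA, enorm_sq_eq_tsum (onb H) (CFC.sqrt A (v _))]
  rw [ENNReal.tsum_comm]
  refine ENNReal.tsum_le_tsum fun j => ?_
  have h1 : ∀ i, ‖⟪onb H j, CFC.sqrt A (v i)⟫_ℂ‖ₑ ^ 2 =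
      ENNReal.ofReal (‖⟪v i, CFC.sqrt A (onb H j)⟫_ℂ‖ ^ 2) := by
    intro i
    rw [← ContinuousLinearMap.adjoint_inner_left, hS.adjoint_eq, ← inner_conj_symm, ← ofReal_norm,
      RCLike.norm_conj, ENNReal.ofReal_pow (norm_nonneg _)]
  simp_rw [h1]
  rw [← ENNReal.ofReal_tsum_of_nonneg (fun _ => by positivity) (hv.inner_products_summable _),
    ← ofReal_norm, ← ENNReal.ofReal_pow (norm_nonneg _)]
  exact ENNReal.ofReal_le_ofReal (hv.tsum_inner_products_le _)

/-- Expand √A x in a basis and apply Cauchy–Schwarz to each coordinate ⟨√A eⱼ, x⟩. -/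
theorem inner_le_traceNorm {A : H →L[ℂ] H} (hA : A.IsPositive) (x : H) :
    ENNReal.ofReal (RCLike.re ⟪x, A x⟫_ℂ) ≤ traceNorm A * ‖x‖ₑ ^ 2 := by
  have hS : IsSelfAdjoint (CFC.sqrt A) := (CFC.sqrt_nonneg _).isSelfAdjoint
  rw [traceNorm_eq_tsum (onb H) hA]
  simp_rw [inner_self_eq_enorm_sqrt_sq hA]
  rw [enorm_sq_eq_tsum (onb H) (CFC.sqrt A x), ← ENNReal.tsum_mul_right]
  refine ENNReal.tsum_le_tsum fun j => ?_
  rw [← ContinuousLinearMap.adjoint_inner_left, hS.adjoint_eq, ← mul_pow]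
  gcongr
  rw [← ofReal_norm, ← ofReal_norm, ← ofReal_norm, ← ENNReal.ofReal_mul (norm_nonneg _)]
  exact ENNReal.ofReal_le_ofReal (norm_inner_le_norm _ _)

theorem enorm_le_traceNorm {A : H →L[ℂ] H} (hA : A.IsPositive) : ‖A‖ₑ ≤ traceNorm A := by
  rcases eq_or_ne (traceNorm A) ∞ with h | h
  · rw [h]; exact le_top
  have hA' : 0 ≤ A := (ContinuousLinearMap.nonneg_iff_isPositive A).2 hA
  have hS : IsSelfAdjoint (CFC.sqrt A) := (CFC.sqrt_nonneg _).isSelfAdjoint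
  have h1 : ‖CFC.sqrt A‖ ≤ √(traceNorm A).toReal := by
    refine ContinuousLinearMap.opNorm_le_bound _ (Real.sqrt_nonneg _) fun x => ?_
    have h2 := inner_le_traceNorm hA x
    rw [inner_self_eq_enorm_sqrt_sq hA, ← ENNReal.ofReal_toReal h, ← ofReal_norm, ← ofReal_norm,
      ← ENNReal.ofReal_pow (norm_nonneg _), ← ENNReal.ofReal_pow (norm_nonneg _),
      ← ENNReal.ofReal_mul ENNReal.toReal_nonneg,
      ENNReal.ofReal_le_ofReal_iff (by positivity)] at h2
    refine (sq_le_sq₀ (norm_nonneg _) (by positivity)).1 ?_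
    rwa [mul_pow, Real.sq_sqrt ENNReal.toReal_nonneg]
  rw [← ofReal_norm, ← ENNReal.ofReal_toReal h]
  refine ENNReal.ofReal_le_ofReal ?_
  calc ‖A‖ = ‖CFC.sqrt A * CFC.sqrt A‖ := by rw [CFC.sqrt_mul_sqrt_self A hA']
    _ ≤ ‖CFC.sqrt A‖ * ‖CFC.sqrt A‖ := norm_mul_le _ _
    _ ≤ √(traceNorm A).toReal * √(traceNorm A).toReal := by gcongr
    _ = _ := Real.mul_self_sqrt ENNReal.toReal_nonneg

theorem trace_eq_traceNorm {A : H →L[ℂ] H} (hA : A.IsPositive) :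
    trace A = ((traceNorm A).toReal : ℂ) := by
  rw [traceNorm_eq_tsum (onb H) hA, ENNReal.tsum_toReal_eq fun _ => ENNReal.ofReal_ne_top, trace,
    Complex.ofReal_tsum]
  refine tsum_congr fun i => ?_
  rw [ENNReal.toReal_ofReal (hA.re_inner_nonneg_right _)]
  exact (coe_re_inner_of_isPositive hA _).symm

/-- Replaces the complex trace by the trace norm, whose sums in `ℝ≥0∞` raise no summability
questions. -/
theorem isDensity_iff {A : H →L[ℂ] H} : IsDensity A ↔ A.IsPositive ∧ traceNorm A = 1 := by
  constructor
  · rintro ⟨h1, h2, h3⟩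
    have h2' : traceNorm A ≠ ∞ := ne_of_lt h2
    refine ⟨h1, ?_⟩
    rw [trace_eq_traceNorm h1] at h3
    have h4 : (traceNorm A).toReal = 1 := by exact_mod_cast h3
    rw [← ENNReal.ofReal_toReal h2', h4, ENNReal.ofReal_one]
  · rintro ⟨h1, h2⟩
    refine ⟨h1, ?_, ?_⟩
    · change traceNorm A < ∞
      rw [h2]; exact ENNReal.one_lt_top
    · rw [trace_eq_traceNorm h1, h2]; simp

end PositiveOperators

/-! ### Diagonal sums with weights, covering both trace and energy -/

section WeightedTrace

variable {H : Type*} [NormedAddCommGroup H] [InnerProductSpace ℂ H]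

/-- The sum `∑ₖ w k ⟨vₖ, A vₖ⟩` of the diagonal entries of `A` against nonnegative weights. -/
def weightedTrace {κ : Type*} (v : HilbertBasis κ ℂ H) (w : κ → ℝ≥0∞) (A : H →L[ℂ] H) : ℝ≥0∞ :=
  ∑' k, w k * ENNReal.ofReal (RCLike.re ⟪v k, A (v k)⟫_ℂ)

theorem weightedTrace_one [CompleteSpace H] {κ : Type*} (v : HilbertBasis κ ℂ H) {A : H →L[ℂ] H}
    (hA : A.IsPositive) : weightedTrace v (fun _ => 1) A = traceNorm A := by
  simp only [weightedTrace, one_mul, traceNorm_eq_tsum v hA]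

theorem weightedTrace_add {κ : Type*} (v : HilbertBasis κ ℂ H) (w : κ → ℝ≥0∞) {A B : H →L[ℂ] H}
    (hA : A.IsPositive) (hB : B.IsPositive) :
    weightedTrace v w (A + B) = weightedTrace v w A + weightedTrace v w B := by
  rw [weightedTrace, weightedTrace, weightedTrace, ← ENNReal.tsum_add]
  refine tsum_congr fun k => ?_
  rw [add_apply, inner_add_right, map_add,
    ENNReal.ofReal_add (hA.re_inner_nonneg_right _) (hB.re_inner_nonneg_right _), mul_add]

theorem weightedTrace_smul {κ : Type*} (v : HilbertBasis κ ℂ H) (w : κ → ℝ≥0∞) (A : H →L[ℂ] H)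
    {c : ℝ} (hc : 0 ≤ c) :
    weightedTrace v w ((c : ℂ) • A) = ENNReal.ofReal c * weightedTrace v w A := by
  rw [weightedTrace, weightedTrace, ← ENNReal.tsum_mul_left]
  refine tsum_congr fun k => ?_
  rw [smul_apply, inner_smul_right, ← mul_assoc, mul_comm (ENNReal.ofReal c), mul_assoc,
    ← ENNReal.ofReal_mul hc]
  congr 2
  exact Complex.re_ofReal_mul _ _

theorem traceNorm_add_of_isPositive [CompleteSpace H] {A B : H →L[ℂ] H}
    (hA : A.IsPositive) (hB : B.IsPositive) :
    traceNorm (A + B) = traceNorm A + traceNorm B := by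
  rw [← weightedTrace_one (onb H) hA, ← weightedTrace_one (onb H) hB,
    ← weightedTrace_one (onb H) (hA.add hB), weightedTrace_add _ _ hA hB]

theorem weightedTrace_mono {κ : Type*} (v : HilbertBasis κ ℂ H) (w : κ → ℝ≥0∞) {A B : H →L[ℂ] H}
    (h : (B - A).IsPositive) : weightedTrace v w A ≤ weightedTrace v w B := by
  refine ENNReal.tsum_le_tsum fun k => ?_
  gcongr w k * ENNReal.ofReal ?_
  have := h.re_inner_nonneg_right (v k)
  rw [sub_apply, inner_sub_right, map_sub] at this
  exact sub_nonneg.1 this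

/-- The positive and negative parts of a self-adjoint operator. -/
theorem exists_jordan_decomposition [CompleteSpace H] {A : H →L[ℂ] H} (hA : IsSelfAdjoint A) :
    ∃ B C : H →L[ℂ] H, B.IsPositive ∧ C.IsPositive ∧ A = B - C ∧
      traceNorm B + traceNorm C = traceNorm A := by
  have h1 := (ContinuousLinearMap.nonneg_iff_isPositive _).1 (CFC.posPart_nonneg A)
  have h2 := (ContinuousLinearMap.nonneg_iff_isPositive _).1 (CFC.negPart_nonneg A)
  refine ⟨A⁺, A⁻, h1, h2, (CFC.posPart_sub_negPart A hA).symm, ?_⟩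
  rw [← traceNorm_add_of_isPositive h1 h2, CFC.posPart_add_negPart A hA, traceNorm, traceNorm,
    CFC.abs_of_nonneg _ (CFC.abs_nonneg A)]

end WeightedTrace

/-! ### Convergent sums of positive operators -/

section HasSum

variable {H : Type*} [NormedAddCommGroup H] [InnerProductSpace ℂ H]

theorem eq_zero_of_forall_inner_eq_zero {ι : Type*} (e : HilbertBasis ι ℂ H) {x : H}
    (h : ∀ i, ⟪e i, x⟫_ℂ = 0) : x = 0 := by
  have h1 := enorm_sq_eq_tsum e x
  simpa [h] using h1

theorem isPositive_of_forall_inner {A : H →L[ℂ] H}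
    (h : ∀ x, ∃ r : ℝ, 0 ≤ r ∧ ⟪x, A x⟫_ℂ = r) : A.IsPositive := by
  rw [ContinuousLinearMap.isPositive_iff_complex]
  intro x
  obtain ⟨r, hr, hx⟩ := h x
  rw [← inner_conj_symm, hx]
  simpa using hr

theorem isPositive_of_hasSum {ι : Type*} {T : ι → H →L[ℂ] H} {A : H →L[ℂ] H}
    (hT : ∀ i, (T i).IsPositive) (hA : HasSum T A) : A.IsPositive := by
  refine isPositive_of_forall_inner fun x => ?_
  have h1 : HasSum (fun i => ⟪x, T i x⟫_ℂ) ⟪x, A x⟫_ℂ :=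
    hA.mapL (innerSL ℂ x ∘L ContinuousLinearMap.apply ℂ H x)
  refine ⟨RCLike.re ⟪x, A x⟫_ℂ, (Complex.hasSum_re h1).nonneg fun i =>
    (hT i).re_inner_nonneg_right x, ?_⟩
  have h2 : (⟪x, A x⟫_ℂ).im = 0 := by
    refine (Complex.hasSum_im h1).unique ?_
    convert hasSum_zero with i
    rw [← coe_re_inner_of_isPositive (hT i)]
    simp
  exact Complex.ext (by simp) (by simpa using h2)

/-- The remainder is itself a convergent sum of positive operators. This replaces continuity of the
channel in `IsCPTP.exists_output`. -/
theorem isPositive_sub_of_hasSum {ι : Type*} {T : ι → H →L[ℂ] H} {A : H →L[ℂ] H}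
    (hT : ∀ i, (T i).IsPositive) (hA : HasSum T A) (s : Finset ι) :
    (A - ∑ i ∈ s, T i).IsPositive := by
  have h1 : HasSum (fun i : {i // i ∉ s} => T i) (A - ∑ i ∈ s, T i) := by
    rw [Finset.hasSum_compl_iff]
    simpa using hA
  exact isPositive_of_hasSum (T := fun i : {i // i ∉ s} => T i) (fun i => hT i) h1

end HasSum

/-! ### Blocks, product bases and the partial trace -/

section Tensor

variable {R : Type*} [NormedAddCommGroup R] [InnerProductSpace ℂ R]
variable {H : Type*} [NormedAddCommGroup H] [InnerProductSpace ℂ H]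

theorem ketTensor_apply (f : R) (x : H) : ketTensor f x = ((f ⊗ₜ[ℂ] x : R ⊗[ℂ] H) : HTensor R H) :=
  rfl

theorem inner_ketTensor (f g : R) (x y : H) :
    ⟪ketTensor f x, ketTensor g y⟫_ℂ = ⟪f, g⟫_ℂ * ⟪x, y⟫_ℂ := by
  rw [ketTensor_apply, ketTensor_apply, UniformSpace.Completion.inner_coe,
    TensorProduct.inner_tmul]

theorem eq_zero_of_forall_inner_ketTensor {w : HTensor R H}
    (h : ∀ (f : R) (x : H), ⟪ketTensor f x, w⟫_ℂ = 0) : w = 0 := by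
  have h1 : ∀ u : R ⊗[ℂ] H, ⟪(u : HTensor R H), w⟫_ℂ = 0 := by
    intro u
    induction u with
    | zero => rw [UniformSpace.Completion.coe_zero, inner_zero_left]
    | tmul f x => exact h f x
    | add u v hu hv => rw [UniformSpace.Completion.coe_add, inner_add_left, hu, hv, add_zero]
  have h2 : ∀ u : HTensor R H, ⟪u, w⟫_ℂ = 0 := by
    intro u
    induction u using UniformSpace.Completion.induction_on with
    | hp => exact isClosed_eq (by fun_prop) continuous_const
    | ih u => exact h1 u
  exact inner_self_eq_zero.1 (h2 w)

theorem orthonormal_ketTensor {ι κ : Type*} {e : ι → R} {b : κ → H} (he : Orthonormal ℂ e)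
    (hb : Orthonormal ℂ b) : Orthonormal ℂ fun p : ι × κ => ketTensor (e p.1) (b p.2) := by
  classical
  rw [orthonormal_iff_ite] at he hb ⊢
  rintro ⟨i, k⟩ ⟨j, l⟩
  rw [inner_ketTensor, he, hb]
  by_cases h : i = j <;> simp [Prod.ext_iff, h]

variable [CompleteSpace H]

theorem inner_block (X : HTensor R H →L[ℂ] HTensor R H) (f g : R) (x y : H) :
    ⟪x, block X f g y⟫_ℂ = ⟪ketTensor f x, X (ketTensor g y)⟫_ℂ := by
  rw [block, ContinuousLinearMap.comp_apply, ContinuousLinearMap.comp_apply,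
    ContinuousLinearMap.adjoint_inner_right]

/-- An operator on `R ⊗ H` is determined by its blocks. -/
theorem ext_block {X Y : HTensor R H →L[ℂ] HTensor R H} (h : ∀ f g, block X f g = block Y f g) :
    X = Y := by
  have h1 : ∀ g y, (X - Y) (ketTensor g y) = 0 := fun g y =>
    eq_zero_of_forall_inner_ketTensor fun f x => by
      rw [sub_apply, inner_sub_right, ← inner_block, ← inner_block, h, sub_self]
  have h2 : ∀ w, ContinuousLinearMap.adjoint (X - Y) w = 0 := fun w =>
    eq_zero_of_forall_inner_ketTensor fun g y => by
      rw [ContinuousLinearMap.adjoint_inner_right, h1, inner_zero_left]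
  have h3 : ContinuousLinearMap.adjoint (X - Y) = 0 := ContinuousLinearMap.ext h2
  refine sub_eq_zero.1 ?_
  rw [← ContinuousLinearMap.adjoint_adjoint (X - Y), h3, map_zero]

theorem block_add (X Y : HTensor R H →L[ℂ] HTensor R H) (f g : R) :
    block (X + Y) f g = block X f g + block Y f g := by
  ext x; simp [block]

theorem block_smul (c : ℂ) (X : HTensor R H →L[ℂ] HTensor R H) (f g : R) :
    block (c • X) f g = c • block X f g := by
  ext x; simp [block]

theorem block_sub (X Y : HTensor R H →L[ℂ] HTensor R H) (f g : R) :
    block (X - Y) f g = block X f g - block Y f g := by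
  ext x; simp [block]

theorem block_add_left (X : HTensor R H →L[ℂ] HTensor R H) (f f' g : R) :
    block X (f + f') g = block X f g + block X f' g := by
  refine ContinuousLinearMap.ext fun y => ext_inner_left ℂ fun x => ?_
  rw [add_apply, inner_add_right, inner_block, inner_block, inner_block, ← inner_add_left]
  congr 1
  simp only [ketTensor_apply, TensorProduct.add_tmul, UniformSpace.Completion.coe_add]

theorem block_smul_left (X : HTensor R H →L[ℂ] HTensor R H) (c : ℂ) (f g : R) :
    block X (c • f) g = (starRingEnd ℂ) c • block X f g := by
  refine ContinuousLinearMap.ext fun y => ext_inner_left ℂ fun x => ?_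
  rw [smul_apply, inner_smul_right, inner_block, inner_block, ← inner_smul_left]
  congr 1
  simp only [ketTensor_apply, ← TensorProduct.smul_tmul', UniformSpace.Completion.coe_smul]

theorem block_add_right (X : HTensor R H →L[ℂ] HTensor R H) (f g g' : R) :
    block X f (g + g') = block X f g + block X f g' := by
  refine ContinuousLinearMap.ext fun y => ext_inner_left ℂ fun x => ?_
  rw [add_apply, inner_add_right, inner_block, inner_block, inner_block, ← inner_add_right,
    ← map_add]
  congr 2
  simp only [ketTensor_apply, TensorProduct.add_tmul, UniformSpace.Completion.coe_add]

theorem block_smul_right (X : HTensor R H →L[ℂ] HTensor R H) (c : ℂ) (f g : R) :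
    block X f (c • g) = c • block X f g := by
  refine ContinuousLinearMap.ext fun y => ext_inner_left ℂ fun x => ?_
  rw [smul_apply, inner_smul_right, inner_block, inner_block, ← inner_smul_right, ← map_smul]
  congr 2
  simp only [ketTensor_apply, ← TensorProduct.smul_tmul', UniformSpace.Completion.coe_smul]

theorem isPositive_block {X : HTensor R H →L[ℂ] HTensor R H} (hX : X.IsPositive) (f : R) :
    (block X f f).IsPositive :=
  hX.adjoint_conj _

/-- The vectors fᵢ ⊗ eₖ are orthonormal, so Bessel's form of the trace bound applies. -/
theorem sum_traceNorm_block_le {ι : Type*} [Fintype ι] {f : ι → R} (hf : Orthonormal ℂ f)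
    {X : HTensor R H →L[ℂ] HTensor R H} (hX : X.IsPositive) :
    ∑ i, traceNorm (block X (f i) (f i)) ≤ traceNorm X := by
  refine le_trans (le_of_eq ?_)
    (tsum_inner_le_traceNorm (orthonormal_ketTensor hf (onb H).orthonormal) hX)
  rw [ENNReal.tsum_prod', tsum_fintype]
  refine Finset.sum_congr rfl fun i _ => ?_
  rw [traceNorm_eq_tsum (onb H) (isPositive_block hX _)]
  simp only [inner_block]

variable [CompleteSpace R]

/-- The product `eᵢ ⊗ bₖ` of two Hilbert bases. -/
def tensorBasis {ι κ : Type*} (e : HilbertBasis ι ℂ R) (b : HilbertBasis κ ℂ H) :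
    HilbertBasis (ι × κ) ℂ (HTensor R H) :=
  HilbertBasis.mkOfOrthogonalEqBot (orthonormal_ketTensor e.orthonormal b.orthonormal) <| by
    rw [eq_bot_iff]
    intro w hw
    have h1 : ∀ i k, ⟪ketTensor (e i) (b k), w⟫_ℂ = 0 := fun i k =>
      (Submodule.mem_orthogonal _ _).1 hw _ (Submodule.subset_span ⟨(i, k), rfl⟩)
    have h2 : ∀ i, ContinuousLinearMap.adjoint (ketTensor (H := H) (e i)) w = 0 := fun i =>
      eq_zero_of_forall_inner_eq_zero b fun k => by
        rw [ContinuousLinearMap.adjoint_inner_right, h1]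
    refine (Submodule.mem_bot ℂ).2 (eq_zero_of_forall_inner_ketTensor fun f x => ?_)
    let g : R →L[ℂ] HTensor R H :=
      UniformSpace.Completion.toComplL ∘L (TensorProduct.mkL ℂ R H).flip x
    have h3 : ContinuousLinearMap.adjoint g w = 0 :=
      eq_zero_of_forall_inner_eq_zero e fun i => by
        rw [ContinuousLinearMap.adjoint_inner_right]
        change ⟪ketTensor (e i) x, w⟫_ℂ = 0
        rw [← ContinuousLinearMap.adjoint_inner_right, h2, inner_zero_right]
    change ⟪g f, w⟫_ℂ = 0
    rw [← ContinuousLinearMap.adjoint_inner_right, h3, inner_zero_right]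

theorem tensorBasis_apply {ι κ : Type*} (e : HilbertBasis ι ℂ R) (b : HilbertBasis κ ℂ H)
    (p : ι × κ) : tensorBasis e b p = ketTensor (e p.1) (b p.2) := by
  rw [tensorBasis, HilbertBasis.coe_mkOfOrthogonalEqBot]

/-- The weighted trace on `R ⊗ H`, summed over blocks. -/
theorem weightedTrace_tensorBasis {ι κ : Type*} (e : HilbertBasis ι ℂ R) (b : HilbertBasis κ ℂ H)
    (w : κ → ℝ≥0∞) (X : HTensor R H →L[ℂ] HTensor R H) :
    weightedTrace (tensorBasis e b) (fun p => w p.2) X =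
      ∑' i, weightedTrace b w (block X (e i) (e i)) := by
  rw [weightedTrace, ENNReal.tsum_prod']
  simp only [weightedTrace, tensorBasis_apply, inner_block]

theorem traceNorm_eq_tsum_block {ι : Type*} (e : HilbertBasis ι ℂ R)
    {X : HTensor R H →L[ℂ] HTensor R H} (hX : X.IsPositive) :
    traceNorm X = ∑' i, traceNorm (block X (e i) (e i)) := by
  rw [← weightedTrace_one (tensorBasis e (onb H)) hX]
  refine (weightedTrace_tensorBasis e (onb H) (fun _ => 1) X).trans (tsum_congr fun i => ?_)
  rw [weightedTrace_one _ (isPositive_block hX _)]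

/-- Operator norms of the positive blocks are at most their traces, which sum to Tr X; so the `tsum`
defining the partial trace is a genuine limit and not the default value 0. -/
theorem hasSum_partialTrace {X : HTensor R H →L[ℂ] HTensor R H} (hX : X.IsPositive)
    (h : traceNorm X ≠ ∞) : HasSum (fun i => block X (onb R i) (onb R i)) (partialTrace X) := by
  refine Summable.hasSum (Summable.of_norm ?_)
  rw [traceNorm_eq_tsum_block (onb R) hX] at h
  refine (ENNReal.summable_toReal h).of_nonneg_of_le (fun _ => norm_nonneg _) fun i => ?_
  rw [← toReal_enorm]
  exact ENNReal.toReal_mono (ENNReal.ne_top_of_tsum_ne_top h i)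
    (enorm_le_traceNorm (isPositive_block hX _))

theorem hasSum_inner_partialTrace {X : HTensor R H →L[ℂ] HTensor R H} (hX : X.IsPositive)
    (h : traceNorm X ≠ ∞) (x : H) :
    HasSum (fun i => RCLike.re ⟪x, block X (onb R i) (onb R i) x⟫_ℂ)
      (RCLike.re ⟪x, partialTrace X x⟫_ℂ) :=
  Complex.hasSum_re ((hasSum_partialTrace hX h).mapL
    (innerSL ℂ x ∘L ContinuousLinearMap.apply ℂ H x))

theorem weightedTrace_partialTrace {κ : Type*} (b : HilbertBasis κ ℂ H) (w : κ → ℝ≥0∞)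
    {X : HTensor R H →L[ℂ] HTensor R H} (hX : X.IsPositive) (h : traceNorm X ≠ ∞) :
    weightedTrace b w (partialTrace X) =
      weightedTrace (tensorBasis (onb R) b) (fun p => w p.2) X := by
  rw [weightedTrace_tensorBasis]
  simp only [weightedTrace]
  rw [ENNReal.tsum_comm]
  refine tsum_congr fun k => ?_
  rw [ENNReal.tsum_mul_left, ← (hasSum_inner_partialTrace hX h (b k)).tsum_eq,
    ENNReal.ofReal_tsum_of_nonneg
      (fun i => (isPositive_block hX _).re_inner_nonneg_right _)
      (hasSum_inner_partialTrace hX h (b k)).summable]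

theorem isPositive_partialTrace {X : HTensor R H →L[ℂ] HTensor R H} (hX : X.IsPositive)
    (h : traceNorm X ≠ ∞) : (partialTrace X).IsPositive :=
  isPositive_of_hasSum (fun _ => isPositive_block hX _) (hasSum_partialTrace hX h)

theorem traceNorm_partialTrace {X : HTensor R H →L[ℂ] HTensor R H} (hX : X.IsPositive)
    (h : traceNorm X ≠ ∞) : traceNorm (partialTrace X) = traceNorm X := by
  rw [← weightedTrace_one (onb H) (isPositive_partialTrace hX h),
    weightedTrace_partialTrace _ _ hX h, weightedTrace_one _ hX]

end Tensor

/-! ### From positive forms to operators on the completed tensor product -/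

section SesquilinearForms

/-- Polarisation: reality at u + v and at u + iv fixes the imaginary and the real part. -/
theorem form_symm {V : Type*} [AddCommGroup V] [Module ℂ V] (B : V →ₗ⋆[ℂ] V →ₗ[ℂ] ℂ)
    (hB : ∀ v, (B v v).im = 0) (u v : V) : starRingEnd ℂ (B v u) = B u v := by
  have h1 := hB (u + v)
  have h2 := hB (u + Complex.I • v)
  simp only [map_add, LinearMap.map_smulₛₗ, LinearMap.add_apply, LinearMap.smul_apply, map_smul,
    smul_eq_mul, Complex.conj_I, Complex.add_im, Complex.mul_im, Complex.neg_im, Complex.neg_re,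
    Complex.I_im, Complex.I_re, hB] at h1 h2
  simp only [Complex.add_re, Complex.mul_re, Complex.neg_re, Complex.neg_im, Complex.I_re,
    Complex.I_im, hB] at h2
  apply Complex.ext
  · rw [Complex.conj_re]; linarith
  · rw [Complex.conj_im]; linarith

theorem norm_form_le {V : Type*} [AddCommGroup V] [Module ℂ V] (B : V →ₗ⋆[ℂ] V →ₗ[ℂ] ℂ)
    (hB : ∀ v, 0 ≤ (B v v).re ∧ (B v v).im = 0) (u v : V) :
    ‖B u v‖ ≤ √(B u u).re * √(B v v).re := by
  let _ : PreInnerProductSpace.Core ℂ V :=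
    { inner := fun u v => B u v
      conj_inner_symm := form_symm B fun v => (hB v).2
      re_inner_nonneg := fun v => (hB v).1
      add_left := fun x y z => by simp
      smul_left := fun x y r => by simp }
  exact InnerProductSpace.Core.norm_inner_le_norm (𝕜 := ℂ) u v

/-- A bounded positive sesquilinear form on a pre-Hilbert space is given by a positive operator on
the completion. -/
theorem exists_isPositive_of_form {V : Type*} [NormedAddCommGroup V] [InnerProductSpace ℂ V]
    (B : V →ₗ⋆[ℂ] V →ₗ[ℂ] ℂ) (hB : ∀ v, 0 ≤ (B v v).re ∧ (B v v).im = 0) (C : ℝ)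
    (hC : ∀ v, (B v v).re ≤ C * ‖v‖ ^ 2) :
    ∃ X : UniformSpace.Completion V →L[ℂ] UniformSpace.Completion V, X.IsPositive ∧
      ∀ u v : V, ⟪(u : UniformSpace.Completion V), X v⟫_ℂ = B u v := by
  have hs : ∀ v, √(B v v).re ≤ √C * ‖v‖ := fun v => by
    rcases le_total 0 C with h | h
    · rw [← Real.sqrt_sq (norm_nonneg v), ← Real.sqrt_mul h]
      exact Real.sqrt_le_sqrt (hC v)
    · have : (B v v).re ≤ 0 := (hC v).trans (mul_nonpos_of_nonpos_of_nonneg h (by positivity))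
      rw [Real.sqrt_eq_zero_of_nonpos this]
      positivity
  have hbd : ∀ u v, ‖B u v‖ ≤ (√C * √C) * ‖u‖ * ‖v‖ := fun u v =>
    (norm_form_le B hB u v).trans <| (mul_le_mul (hs u) (hs v) (Real.sqrt_nonneg _)
      (by positivity)).trans_eq (by ring)
  let B₁ : V →L⋆[ℂ] V →L[ℂ] ℂ := B.mkContinuous₂ _ hbd
  let ι : V →L[ℂ] UniformSpace.Completion V := UniformSpace.Completion.toComplL
  have hd : DenseRange ι := UniformSpace.Completion.denseRange_coe
  have hι : IsUniformInducing ι := UniformSpace.Completion.isUniformInducing_coe V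
  -- The form is extended to the completion one variable at a time, with a flip in between.
  let B₂ : V →L[ℂ] UniformSpace.Completion V →L⋆[ℂ] ℂ := (B₁.extend ι).flip
  let B₃ : UniformSpace.Completion V →L⋆[ℂ] UniformSpace.Completion V →L[ℂ] ℂ :=
    (B₂.extend ι).flip
  have hB₃ : ∀ u v : V, B₃ u v = B u v := by
    intro u v
    change B₂.extend ι (ι v) (ι u) = B u v
    rw [ContinuousLinearMap.extend_eq _ hd hι]
    change B₁.extend ι (ι u) v = B u v
    rw [ContinuousLinearMap.extend_eq _ hd hι]
    rfl
  let X := InnerProductSpace.continuousLinearMapOfBilin B₃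
  have hX : ∀ u v, ⟪X u, v⟫_ℂ = B₃ u v :=
    InnerProductSpace.continuousLinearMapOfBilin_apply B₃
  have hpos : X.IsPositive := by
    rw [ContinuousLinearMap.isPositive_iff_complex]
    intro x
    induction x using UniformSpace.Completion.induction_on with
    | hp =>
      have hc : Continuous fun x => ⟪X x, x⟫_ℂ := by fun_prop
      exact IsClosed.inter
        (isClosed_eq (Complex.continuous_ofReal.comp (Complex.continuous_re.comp hc)) hc)
        (isClosed_Ici.preimage (Complex.continuous_re.comp hc))
    | ih v =>
      rw [hX, hB₃]
      exact ⟨Complex.ext (by simp) (by simpa using (hB v).2.symm), (hB v).1⟩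
  refine ⟨X, hpos, fun u v => ?_⟩
  have h : ⟪X (u : UniformSpace.Completion V), (v : UniformSpace.Completion V)⟫_ℂ = _ :=
    hpos.inner_left_eq_inner_right _ _
  rw [← h, hX, hB₃]

variable {R : Type*} [NormedAddCommGroup R] [InnerProductSpace ℂ R]
variable {H : Type*} [NormedAddCommGroup H] [InnerProductSpace ℂ H]

/-- Every element of `R ⊗ H` is a finite sum `∑ᵢ fᵢ ⊗ xᵢ` with orthonormal `fᵢ`. -/
theorem exists_orthonormal_sum_tmul (u : R ⊗[ℂ] H) :
    ∃ (n : ℕ) (f : Fin n → R) (x : Fin n → H), Orthonormal ℂ f ∧ u = ∑ i, f i ⊗ₜ[ℂ] x i := by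
  -- A single tensor involves only a finite-dimensional subspace of R, so its orthonormal basis
  -- supplies the fᵢ.
  obtain ⟨M, hM, h⟩ :=
    TensorProduct.exists_finite_submodule_left_of_setFinite {u} (Set.finite_singleton u)
  obtain ⟨y, rfl⟩ := Set.singleton_subset_iff.1 h
  let e := stdOrthonormalBasis ℂ M
  refine ⟨_, fun i => (e i : R), ?_⟩
  have hy : ∃ x : Fin (Module.finrank ℂ M) → H, y = ∑ i, e i ⊗ₜ[ℂ] x i := by
    clear h
    induction y with
    | zero => exact ⟨0, by simp⟩
    | tmul m z =>
      refine ⟨fun i => e.repr m i • z, ?_⟩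
      simp_rw [← TensorProduct.smul_tmul, ← TensorProduct.sum_tmul, e.sum_repr]
    | add y z hy hz =>
      obtain ⟨x, rfl⟩ := hy
      obtain ⟨x', rfl⟩ := hz
      exact ⟨x + x', by simp [TensorProduct.tmul_add, Finset.sum_add_distrib]⟩
  obtain ⟨x, rfl⟩ := hy
  exact ⟨x, e.orthonormal.comp_linearIsometry M.subtypeₗᵢ, by simp⟩

theorem norm_sq_sum_tmul {n : ℕ} {f : Fin n → R} (hf : Orthonormal ℂ f) (x : Fin n → H) :
    ‖∑ i, f i ⊗ₜ[ℂ] x i‖ ^ 2 = ∑ i, ‖x i‖ ^ 2 := by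
  rw [orthonormal_iff_ite] at hf
  rw [← inner_self_eq_norm_sq (𝕜 := ℂ), sum_inner]
  simp_rw [inner_sum, TensorProduct.inner_tmul, hf]
  simp [← inner_self_eq_norm_sq (𝕜 := ℂ)]

/-- The form `(f ⊗ x, g ⊗ y) ↦ ⟨x, Θ f g y⟩` on the algebraic tensor product. -/
def blockForm (Θ : R →ₗ⋆[ℂ] R →ₗ[ℂ] (H →L[ℂ] H)) : (R ⊗[ℂ] H) →ₗ⋆[ℂ] (R ⊗[ℂ] H) →ₗ[ℂ] ℂ :=
  TensorProduct.lift (LinearMap.mk₂'ₛₗ (starRingEnd ℂ) (starRingEnd ℂ)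
    (fun f x => TensorProduct.lift (LinearMap.mk₂ ℂ (fun g y => ⟪x, Θ f g y⟫_ℂ)
      (fun g g' y => by simp) (fun c g y => by simp) (fun g y y' => by simp)
      (fun c g y => by simp)))
    (fun f f' x => by ext; simp) (fun c f x => by ext; simp) (fun f x x' => by ext; simp)
    (fun c f x => by ext; simp [mul_comm]))

theorem blockForm_tmul (Θ : R →ₗ⋆[ℂ] R →ₗ[ℂ] (H →L[ℂ] H)) (f g : R) (x y : H) :
    blockForm Θ (f ⊗ₜ x) (g ⊗ₜ y) = ⟪x, Θ f g y⟫_ℂ :=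
  rfl

theorem blockForm_sum_tmul (Θ : R →ₗ⋆[ℂ] R →ₗ[ℂ] (H →L[ℂ] H)) {n : ℕ} (f : Fin n → R)
    (x : Fin n → H) :
    blockForm Θ (∑ i, f i ⊗ₜ x i) (∑ i, f i ⊗ₜ x i) =
      ∑ i, ∑ j, ⟪x i, Θ (f i) (f j) (x j)⟫_ℂ := by
  simp only [map_sum, LinearMap.sum_apply, blockForm_tmul]
  exact Finset.sum_comm

end SesquilinearForms

/-! ### Extension of channels to a composite system -/

section Channels

variable {R : Type*} [NormedAddCommGroup R] [InnerProductSpace ℂ R]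
variable {H : Type*} [NormedAddCommGroup H] [InnerProductSpace ℂ H] [CompleteSpace H]
variable {Ψ : TraceClass H →ₗ[ℂ] TraceClass H}

open scoped ComplexOrder in
theorem IsCompletelyPositive.isPositive (hΨ : IsCompletelyPositive Ψ) {T : TraceClass H}
    (hT : (T : H →L[ℂ] H).IsPositive) : (Ψ T : H →L[ℂ] H).IsPositive := by
  have h := hΨ 1 (fun _ _ => T) fun x => by simpa using hT.inner_nonneg_right (x 0)
  refine isPositive_of_forall_inner fun x => ?_
  have h1 := h fun _ => x
  simp only [Finset.univ_unique, Finset.sum_const, Finset.card_singleton, one_smul] at h1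
  obtain ⟨h2, h3⟩ := Complex.nonneg_iff.1 h1
  exact ⟨_, h2, Complex.ext (by simp) (by simpa using h3.symm)⟩

theorem IsCPTP.traceNorm_eq (hΨ : IsCPTP Ψ) {T : TraceClass H}
    (hT : (T : H →L[ℂ] H).IsPositive) :
    traceNorm (Ψ T : H →L[ℂ] H) = traceNorm (T : H →L[ℂ] H) := by
  have h := hΨ.2 T
  rw [trace_eq_traceNorm hT, trace_eq_traceNorm (hΨ.1.isPositive hT)] at h
  exact (ENNReal.toReal_eq_toReal_iff' (ne_of_lt (Ψ T).2) (ne_of_lt T.2)).1 (by exact_mod_cast h)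

/-- The blocks `Ψ ((⟨f| ⊗ I) ρ (|g⟩ ⊗ I))` as a sesquilinear map. -/
def mappedBlock (Ψ : TraceClass H →ₗ[ℂ] TraceClass H) (ρ : TraceClass (HTensor R H)) :
    R →ₗ⋆[ℂ] R →ₗ[ℂ] (H →L[ℂ] H) :=
  LinearMap.mk₂'ₛₗ (starRingEnd ℂ) (RingHom.id ℂ)
    (fun f g => (Ψ (blockTC ρ f g) : H →L[ℂ] H))
    (fun f f' g => by
      rw [show blockTC ρ (f + f') g = blockTC ρ f g + blockTC ρ f' g from
        Subtype.ext (block_add_left _ _ _ _), map_add]; rfl)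
    (fun c f g => by
      rw [show blockTC ρ (c • f) g = (starRingEnd ℂ) c • blockTC ρ f g from
        Subtype.ext (block_smul_left _ _ _ _), map_smul]; rfl)
    (fun f g g' => by
      rw [show blockTC ρ f (g + g') = blockTC ρ f g + blockTC ρ f g' from
        Subtype.ext (block_add_right _ _ _ _), map_add]; rfl)
    (fun c f g => by
      rw [show blockTC ρ f (c • g) = c • blockTC ρ f g from
        Subtype.ext (block_smul_right _ _ _ _), map_smul]; rfl)

theorem mappedBlock_apply (Ψ : TraceClass H →ₗ[ℂ] TraceClass H) (ρ : TraceClass (HTensor R H))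
    (f g : R) : mappedBlock Ψ ρ f g = (Ψ (blockTC ρ f g) : H →L[ℂ] H) :=
  rfl

open scoped ComplexOrder in
-- A tensor has finitely many terms fᵢ ⊗ xᵢ, so complete positivity for the finite matrix of blocks
-- of ρ at the fᵢ suffices.
theorem blockForm_mappedBlock_nonneg (hΨ : IsCompletelyPositive Ψ) {ρ : TraceClass (HTensor R H)}
    (hρ : (ρ : HTensor R H →L[ℂ] HTensor R H).IsPositive) (u : R ⊗[ℂ] H) :
    0 ≤ blockForm (mappedBlock Ψ ρ) u u := by
  obtain ⟨n, f, x, -, rfl⟩ := exists_orthonormal_sum_tmul u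
  rw [blockForm_sum_tmul]
  refine hΨ n (fun i j => blockTC ρ (f i) (f j)) (fun y => ?_) x
  have h := hρ.inner_nonneg_right (∑ i, ketTensor (f i) (y i))
  rw [map_sum, sum_inner] at h
  simp_rw [inner_sum] at h
  simpa only [blockTC, inner_block] using h

/-- Cauchy–Schwarz for the form reduces to its diagonal, where positivity and trace preservation
give tᵢ‖xᵢ‖² with tᵢ the trace of the i-th block of ρ. A second Cauchy–Schwarz and ∑ tᵢ ≤ Tr ρ
finish. -/
theorem blockForm_mappedBlock_le (hΨ : IsCPTP Ψ) {ρ : TraceClass (HTensor R H)}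
    (hρ : (ρ : HTensor R H →L[ℂ] HTensor R H).IsPositive) (u : R ⊗[ℂ] H) :
    (blockForm (mappedBlock Ψ ρ) u u).re ≤
      (traceNorm (ρ : HTensor R H →L[ℂ] HTensor R H)).toReal * ‖u‖ ^ 2 := by
  have hB : ∀ u, 0 ≤ (blockForm (mappedBlock Ψ ρ) u u).re ∧
      (blockForm (mappedBlock Ψ ρ) u u).im = 0 := fun u => by
    obtain ⟨h1, h2⟩ := Complex.nonneg_iff.1 (blockForm_mappedBlock_nonneg hΨ.1 hρ u)
    exact ⟨h1, h2.symm⟩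
  obtain ⟨n, f, x, hf, rfl⟩ := exists_orthonormal_sum_tmul u
  rw [norm_sq_sum_tmul hf]
  set B := blockForm (mappedBlock Ψ ρ)
  let t : Fin n → ℝ := fun i => (traceNorm (block ρ.1 (f i) (f i))).toReal
  have ht : ∀ i, traceNorm (block ρ.1 (f i) (f i)) ≠ ∞ := fun i =>
    ne_of_lt (blockTC ρ (f i) (f i)).2
  have hdiag : ∀ i, √(B (f i ⊗ₜ x i) (f i ⊗ₜ x i)).re ≤ √(t i) * √(‖x i‖ ^ 2) := by
    intro i
    rw [← Real.sqrt_mul ENNReal.toReal_nonneg]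
    refine Real.sqrt_le_sqrt ?_
    have hpos : ((blockTC ρ (f i) (f i) : TraceClass H) : H →L[ℂ] H).IsPositive :=
      isPositive_block hρ _
    have h1 := inner_le_traceNorm (hΨ.1.isPositive hpos) (x i)
    rw [hΨ.traceNorm_eq hpos] at h1
    have h2 : traceNorm (blockTC ρ (f i) (f i) : H →L[ℂ] H) = ENNReal.ofReal (t i) :=
      (ENNReal.ofReal_toReal (ht i)).symm
    rw [h2, ← ofReal_norm, ← ENNReal.ofReal_pow (norm_nonneg _),
      ← ENNReal.ofReal_mul ENNReal.toReal_nonneg] at h1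
    exact (ENNReal.ofReal_le_ofReal_iff
      (mul_nonneg ENNReal.toReal_nonneg (by positivity))).1 h1
  calc (B (∑ i, f i ⊗ₜ x i) (∑ i, f i ⊗ₜ x i)).re
      = ∑ i, ∑ j, (B (f i ⊗ₜ x i) (f j ⊗ₜ x j)).re := by
        simp only [map_sum, LinearMap.sum_apply, Complex.re_sum]
        exact Finset.sum_comm
    _ ≤ ∑ i, ∑ j, √(B (f i ⊗ₜ x i) (f i ⊗ₜ x i)).re * √(B (f j ⊗ₜ x j) (f j ⊗ₜ x j)).re :=
        Finset.sum_le_sum fun i _ => Finset.sum_le_sum fun j _ =>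
          (Complex.re_le_norm _).trans (norm_form_le B hB _ _)
    _ = (∑ i, √(B (f i ⊗ₜ x i) (f i ⊗ₜ x i)).re) ^ 2 := by
        rw [sq, Finset.sum_mul_sum]
    _ ≤ (∑ i, √(t i) * √(‖x i‖ ^ 2)) ^ 2 := by
        gcongr with i
        exact hdiag i
    _ ≤ (∑ i, t i) * ∑ i, ‖x i‖ ^ 2 := by
        have h1 := Real.sum_sqrt_mul_sqrt_le Finset.univ
          (fun i => ENNReal.toReal_nonneg : ∀ i, 0 ≤ t i) (fun i => sq_nonneg ‖x i‖)
        refine (pow_le_pow_left₀ (Finset.sum_nonneg fun _ _ => by positivity) h1 2).trans_eq ?_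
        rw [mul_pow, Real.sq_sqrt (Finset.sum_nonneg fun _ _ => ENNReal.toReal_nonneg),
          Real.sq_sqrt (Finset.sum_nonneg fun _ _ => by positivity)]
    _ ≤ _ := by
        gcongr
        rw [← ENNReal.toReal_sum fun i _ => ht i]
        exact ENNReal.toReal_mono (ne_of_lt ρ.2) (sum_traceNorm_block_le hf hρ)

/-- A channel extends to `R ⊗ H`: the operator `(Id ⊗ Ψ)(ρ)` exists and is positive. -/
theorem IsCPTP.exists_idTensor (hΨ : IsCPTP Ψ) {ρ : TraceClass (HTensor R H)}
    (hρ : (ρ : HTensor R H →L[ℂ] HTensor R H).IsPositive) :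
    ∃ X : HTensor R H →L[ℂ] HTensor R H, X.IsPositive ∧ IsIdTensor Ψ ρ X := by
  obtain ⟨X, hX, h⟩ := exists_isPositive_of_form (blockForm (mappedBlock Ψ ρ))
    (fun u => by
      obtain ⟨h1, h2⟩ := Complex.nonneg_iff.1 (blockForm_mappedBlock_nonneg hΨ.1 hρ u)
      exact ⟨h1, h2.symm⟩)
    _ (blockForm_mappedBlock_le hΨ hρ)
  refine ⟨X, hX, fun f g => ContinuousLinearMap.ext fun y => ext_inner_left ℂ fun x => ?_⟩
  rw [inner_block, ketTensor_apply, ketTensor_apply, h, blockForm_tmul, mappedBlock_apply]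

end Channels

/-! ### Calculus of ‖(Id ⊗ Φ)(A)‖₁ -/

section IdTensor

variable {R : Type*} [NormedAddCommGroup R] [InnerProductSpace ℂ R]
variable {H : Type*} [NormedAddCommGroup H] [InnerProductSpace ℂ H] [CompleteSpace H]

theorem idTensorTraceNorm_add_le (Φ : TraceClass H →ₗ[ℂ] TraceClass H)
    (A B : TraceClass (HTensor R H)) :
    idTensorTraceNorm Φ (A + B) ≤ idTensorTraceNorm Φ A + idTensorTraceNorm Φ B := by
  simp only [idTensorTraceNorm, ENNReal.iInf_add, ENNReal.add_iInf]
  refine le_iInf₂ fun Z hZ => le_iInf₂ fun Y hY => ?_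
  refine (iInf₂_le (Y + Z) fun f g => ?_).trans (traceNorm_add_le Y Z)
  rw [block_add, hY, hZ, show blockTC (A + B) f g = blockTC A f g + blockTC B f g from
    Subtype.ext (block_add _ _ _ _), map_add]
  rfl

theorem idTensorTraceNorm_smul_le (Φ : TraceClass H →ₗ[ℂ] TraceClass H) {c : ℂ} (hc : c ≠ 0)
    (A : TraceClass (HTensor R H)) :
    idTensorTraceNorm Φ (c • A) ≤ ‖c‖ₑ * idTensorTraceNorm Φ A := by
  simp only [idTensorTraceNorm, ENNReal.mul_iInf_of_ne (enorm_ne_zero.2 hc) enorm_ne_top]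
  refine le_iInf₂ fun Y hY => ?_
  refine (iInf₂_le (c • Y) fun f g => ?_).trans_eq (traceNorm_smul c Y)
  rw [block_smul, hY, show blockTC (c • A) f g = c • blockTC A f g from
    Subtype.ext (block_smul _ _ _ _), map_smul]
  rfl

theorem idTensorTraceNorm_sub_le (Φ : TraceClass H →ₗ[ℂ] TraceClass H)
    (A B : TraceClass (HTensor R H)) :
    idTensorTraceNorm Φ (A - B) ≤ idTensorTraceNorm Φ A + idTensorTraceNorm Φ B := by
  have h := idTensorTraceNorm_smul_le Φ (c := -1) (by simp) B
  rw [enorm_neg, enorm_one, one_mul] at h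
  rw [sub_eq_add_neg, ← neg_one_smul ℂ B]
  exact (idTensorTraceNorm_add_le Φ _ _).trans (by gcongr)

theorem idTensorTraceNorm_zero (Φ : TraceClass H →ₗ[ℂ] TraceClass H) :
    idTensorTraceNorm Φ (0 : TraceClass (HTensor R H)) = 0 := by
  refine le_antisymm ((iInf₂_le 0 fun f g => ?_).trans_eq (by simp [traceNorm])) bot_le
  have h : block (0 : HTensor R H →L[ℂ] HTensor R H) f g = 0 := by
    simpa using block_smul (0 : ℂ) (0 : HTensor R H →L[ℂ] HTensor R H) f g
  rw [show blockTC (0 : TraceClass (HTensor R H)) f g = 0 from Subtype.ext h, map_zero, h]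
  rfl

/-- The infimum runs over at most one operator, as blocks determine it. -/
theorem idTensorTraceNorm_eq (Φ : TraceClass H →ₗ[ℂ] TraceClass H)
    {A : TraceClass (HTensor R H)} {Y : HTensor R H →L[ℂ] HTensor R H} (hY : IsIdTensor Φ A Y) :
    idTensorTraceNorm Φ A = traceNorm Y := by
  refine le_antisymm (iInf₂_le Y hY) (le_iInf₂ fun Z hZ => ?_)
  rw [ext_block fun f g => (hZ f g).trans (hY f g).symm]

theorem idTensorTraceNorm_comp_le (Φ N : TraceClass H →ₗ[ℂ] TraceClass H)
    {A Y : TraceClass (HTensor R H)} (hY : IsIdTensor N A Y) :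
    idTensorTraceNorm (Φ ∘ₗ N) A ≤ idTensorTraceNorm Φ Y := by
  refine le_iInf₂ fun Z hZ => iInf₂_le Z fun f g => ?_
  rw [hZ, LinearMap.comp_apply, show blockTC Y f g = N (blockTC A f g) from Subtype.ext (hY f g)]

theorem IsIdTensor.sub {Φ Ψ : TraceClass H →ₗ[ℂ] TraceClass H} {A : TraceClass (HTensor R H)}
    {Y Z : HTensor R H →L[ℂ] HTensor R H} (hY : IsIdTensor Φ A Y) (hZ : IsIdTensor Ψ A Z) :
    IsIdTensor (Φ - Ψ) A (Y - Z) := fun f g => by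
  rw [block_sub, hY, hZ, LinearMap.sub_apply]
  rfl

end IdTensor

theorem weightedTrace_rankOne {W κ : Type*} [NormedAddCommGroup W] [InnerProductSpace ℂ W]
    (v : HilbertBasis κ ℂ W) (w : κ → ℝ≥0∞) (k : κ) :
    weightedTrace v w (InnerProductSpace.rankOne ℂ (v k) (v k)) = w k := by
  classical
  have hv := orthonormal_iff_ite.1 v.orthonormal
  rw [weightedTrace, tsum_eq_single k]
  · rw [InnerProductSpace.rankOne_apply, inner_smul_right, hv]
    simp
  · intro j hj
    simp [InnerProductSpace.rankOne_apply, hv, hj.symm]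

/-! ### Compressions by diagonal operators -/

section Compression

variable {W : Type*} [NormedAddCommGroup W] [InnerProductSpace ℂ W] [CompleteSpace W]

/-- The compression `D† A D` of a trace-class operator. -/
def conjTC (D : W →L[ℂ] W) (A : TraceClass W) : TraceClass W :=
  ⟨ContinuousLinearMap.adjoint D ∘L A.1 ∘L D, traceNorm_conj_lt_top A.1 A.2 D D⟩

theorem isPositive_conjTC (D : W →L[ℂ] W) {A : TraceClass W} (hA : A.1.IsPositive) :
    (conjTC D A).1.IsPositive :=
  hA.adjoint_conj D

theorem conjTC_sub (D : W →L[ℂ] W) (A B : TraceClass W) :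
    conjTC D (A - B) = conjTC D A - conjTC D B :=
  Subtype.ext (by ext x; simp [conjTC])

theorem weightedTrace_conjTC {κ : Type*} (v : HilbertBasis κ ℂ W) (w : κ → ℝ≥0∞) {D : W →L[ℂ] W}
    {γ : κ → ℝ} (hD : ∀ k, D (v k) = (γ k : ℂ) • v k) (A : TraceClass W) :
    weightedTrace v w (conjTC D A).1 =
      weightedTrace v (fun k => w k * ENNReal.ofReal (γ k ^ 2)) A.1 := by
  refine tsum_congr fun k => ?_
  rw [mul_assoc, ← ENNReal.ofReal_mul (sq_nonneg _)]
  congr 2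
  rw [conjTC, ContinuousLinearMap.comp_apply, ContinuousLinearMap.comp_apply,
    ContinuousLinearMap.adjoint_inner_right, hD, map_smul, inner_smul_left, inner_smul_right,
    ← mul_assoc, Complex.conj_ofReal, ← Complex.ofReal_mul, ← sq]
  exact Complex.re_ofReal_mul _ _

theorem traceNorm_conjTC {κ : Type*} (v : HilbertBasis κ ℂ W) {D : W →L[ℂ] W}
    {γ : κ → ℝ} (hD : ∀ k, D (v k) = (γ k : ℂ) • v k) {A : TraceClass W} (hA : A.1.IsPositive) :
    traceNorm (conjTC D A).1 = weightedTrace v (fun k => ENNReal.ofReal (γ k ^ 2)) A.1 := by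
  rw [← weightedTrace_one v (isPositive_conjTC D hA), weightedTrace_conjTC v _ hD]
  simp only [one_mul]

/-- Turns a pointwise inequality between weights into a trace bound; Markov's inequality is used in
this form. -/
theorem weightedTrace_le_of_le {κ : Type*} (v : HilbertBasis κ ℂ W) {w w' : κ → ℝ≥0∞}
    {A : W →L[ℂ] W} (hA : A.IsPositive) {α β : ℝ≥0∞} (h : ∀ k, w' k ≤ α + β * w k) :
    weightedTrace v w' A ≤ α * traceNorm A + β * weightedTrace v w A := by
  rw [← weightedTrace_one v hA, weightedTrace, weightedTrace, weightedTrace,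
    ← ENNReal.tsum_mul_left, ← ENNReal.tsum_mul_left, ← ENNReal.tsum_add]
  refine ENNReal.tsum_le_tsum fun k => ?_
  rw [one_mul, ← mul_assoc, ← add_mul]
  gcongr
  exact h k

/-- The projection onto the closed span of part of a Hilbert basis. -/
theorem exists_basis_projection {κ : Type*} (v : HilbertBasis κ ℂ W) (S : Set κ)
    [DecidablePred (· ∈ S)] :
    ∃ P : W →L[ℂ] W, ∀ k, P (v k) = ((if k ∈ S then 1 else 0 : ℝ) : ℂ) • v k := by
  let U : Submodule ℂ W := (Submodule.span ℂ (v '' S)).topologicalClosure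
  have : CompleteSpace U := (Submodule.isClosed_topologicalClosure _).completeSpace_coe
  refine ⟨U.starProjection, fun k => ?_⟩
  split_ifs with hk
  · have h : v k ∈ U :=
      Submodule.le_topologicalClosure _ (Submodule.subset_span (Set.mem_image_of_mem v hk))
    rw [Submodule.starProjection_eq_self_iff.2 h, Complex.ofReal_one, one_smul]
  · have h : v k ∈ Uᗮ := by
      rw [Submodule.orthogonal_closure, Submodule.mem_orthogonal]
      intro u hu
      induction hu using Submodule.span_induction with
      | mem x hx =>
        obtain ⟨j, hj, rfl⟩ := hx
        exact v.orthonormal.2 fun h => hk (h ▸ hj)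
      | zero => simp
      | add x y _ _ hx hy => rw [inner_add_left, hx, hy, add_zero]
      | smul c x _ hx => rw [inner_smul_left, hx, mul_zero]
    rw [(Submodule.starProjection_apply_eq_zero_iff U).2 h, Complex.ofReal_zero, zero_smul]

/-- Splitting off the compression by `P`: the remainder is a combination of compressions by
`c P ± d Q` and `Q`, where `Q = 1 - P`. -/
theorem sub_conjTC_eq (P : W →L[ℂ] W) {c d : ℝ} (hcd : c * d = 1) (A : TraceClass W) :
    A - conjTC P A = (2⁻¹ : ℂ) • (conjTC ((c : ℂ) • P + (d : ℂ) • (1 - P)) A -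
      conjTC ((c : ℂ) • P - (d : ℂ) • (1 - P)) A) + conjTC (1 - P) A := by
  have hcd' : (c : ℂ) * d = 1 := by exact_mod_cast hcd
  refine Subtype.ext (ContinuousLinearMap.ext fun x => ext_inner_left ℂ fun y => ?_)
  simp only [conjTC, Submodule.coe_add, Submodule.coe_sub, Submodule.coe_smul, sub_apply, add_apply,
    smul_apply, ContinuousLinearMap.comp_apply, inner_sub_right, inner_add_right, inner_smul_right,
    ContinuousLinearMap.adjoint_inner_right, one_apply_eq_self, map_add, map_sub,
    map_smul, inner_sub_left, inner_smul_left, Complex.conj_ofReal]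
  -- The coefficient is minus the sum of the two cross terms P†A(1 - P) and (1 - P)†AP, which appear
  -- with the factor cd.
  linear_combination (2 * ⟪P y, A.1 (P x)⟫_ℂ - ⟪y, A.1 (P x)⟫_ℂ - ⟪P y, A.1 x⟫_ℂ) * hcd'

end Compression

/-! ### Energy estimates, the cutoff, and outputs of energy-limited channels -/

section EnergyBounds

variable {H : Type*} [NormedAddCommGroup H] [InnerProductSpace ℂ H] [CompleteSpace H]
variable (b : HilbertBasis ℕ ℂ H)

/-- The mean photon number `Tr((I ⊗ n̂) A)` of the second factor. -/
def tensorEnergy (A : HTensor H H →L[ℂ] HTensor H H) : ℝ≥0∞ :=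
  weightedTrace (tensorBasis (onb H) b) (fun p => (p.2 : ℝ≥0∞)) A

theorem energy_partialTrace {A : HTensor H H →L[ℂ] HTensor H H} (hA : A.IsPositive)
    (h : traceNorm A ≠ ∞) : energy b (partialTrace A) = tensorEnergy b A :=
  weightedTrace_partialTrace b (fun n => (n : ℝ≥0∞)) hA h

variable {b} {M : ℝ} (Φ : TraceClass H →ₗ[ℂ] TraceClass H)

theorem idTensorTraceNorm_le_ecDiamondNorm {ρ : TraceClass (HTensor H H)} (hρ : IsDensity ρ.1)
    (hE : partialTrace ρ.1 ∈ energyStates b M) :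
    idTensorTraceNorm Φ ρ ≤ ecDiamondNorm b M Φ :=
  le_iSup₂_of_le ρ hρ (le_iSup_of_le hE le_rfl)

theorem idTensorTraceNorm_le_of_isDensity {ρ : TraceClass (HTensor H H)} (hρ : IsDensity ρ.1)
    (hE : tensorEnergy b ρ.1 ≤ ENNReal.ofReal M) :
    idTensorTraceNorm Φ ρ ≤ ecDiamondNorm b M Φ := by
  obtain ⟨h1, h2⟩ := isDensity_iff.1 hρ
  have h3 : traceNorm ρ.1 ≠ ∞ := ne_of_lt ρ.2
  refine idTensorTraceNorm_le_ecDiamondNorm Φ hρ ⟨isDensity_iff.2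
    ⟨isPositive_partialTrace h1 h3, (traceNorm_partialTrace h1 h3).trans h2⟩, ?_⟩
  rwa [energy_partialTrace b h1 h3]

/-- Homogeneity: A divided by its trace is a state admissible at energy M. -/
theorem idTensorTraceNorm_le_traceNorm_mul {A : TraceClass (HTensor H H)} (hA : A.1.IsPositive)
    (hE : tensorEnergy b A.1 ≤ ENNReal.ofReal M * traceNorm A.1) :
    idTensorTraceNorm Φ A ≤ traceNorm A.1 * ecDiamondNorm b M Φ := by
  have hfin : traceNorm A.1 ≠ ∞ := ne_of_lt A.2
  -- Trace zero cannot be normalised, and as 0 · ∞ = 0 the bound has content even when the norm of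
  -- `Φ` is infinite.
  rcases eq_or_ne (traceNorm A.1) 0 with h0 | h0
  · have h1 : A.1 = 0 := by
      have := enorm_le_traceNorm hA
      rw [h0] at this
      exact enorm_eq_zero.1 (le_antisymm this bot_le)
    rw [show A = 0 from Subtype.ext h1, idTensorTraceNorm_zero]
    exact bot_le
  set a : ℝ := (traceNorm A.1).toReal with ha
  have ha0 : 0 < a := ENNReal.toReal_pos h0 hfin
  have haA : traceNorm A.1 = ENNReal.ofReal a := (ENNReal.ofReal_toReal hfin).symm
  have hac : (a : ℂ) ≠ 0 := by exact_mod_cast ha0.ne'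
  have henorm : ∀ r : ℝ, 0 ≤ r → ‖(r : ℂ)‖ₑ = ENNReal.ofReal r := fun r hr => by
    rw [← ofReal_norm, Complex.norm_of_nonneg hr]
  let ρ : TraceClass (HTensor H H) := ((a⁻¹ : ℝ) : ℂ) • A
  have hinv : ENNReal.ofReal a⁻¹ * ENNReal.ofReal a = 1 := by
    rw [← ENNReal.ofReal_mul (by positivity), inv_mul_cancel₀ ha0.ne', ENNReal.ofReal_one]
  have hρ : IsDensity ρ.1 := by
    refine isDensity_iff.2 ⟨hA.smul_of_nonneg (Complex.zero_le_real.2 (by positivity)), ?_⟩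
    change traceNorm (((a⁻¹ : ℝ) : ℂ) • A.1) = 1
    rw [traceNorm_smul, henorm _ (by positivity), haA, hinv]
  have hρE : tensorEnergy b ρ.1 ≤ ENNReal.ofReal M := by
    refine (weightedTrace_smul _ _ A.1 (c := a⁻¹) (by positivity)).trans_le ?_
    calc ENNReal.ofReal a⁻¹ * tensorEnergy b A.1
        ≤ ENNReal.ofReal a⁻¹ * (ENNReal.ofReal M * ENNReal.ofReal a) := by
          rw [haA] at hE
          gcongr
      _ = ENNReal.ofReal M := by rw [mul_left_comm, hinv, mul_one]
  have hAρ : A = (a : ℂ) • ρ := by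
    rw [smul_smul, Complex.ofReal_inv, mul_inv_cancel₀ hac, one_smul]
  rw [haA, ← henorm a ha0.le]
  conv_lhs => rw [hAρ]
  refine (idTensorTraceNorm_smul_le Φ hac ρ).trans ?_
  gcongr
  exact idTensorTraceNorm_le_of_isDensity Φ hρ hρE

/-- A positive operator of small energy is completed by the vacuum to one whose energy is
proportional to its trace. -/
theorem idTensorTraceNorm_le_ofReal_mul {A : TraceClass (HTensor H H)} (hA : A.1.IsPositive)
    {s t : ℝ} (ht : 0 ≤ t) (hst : 2 * t ≤ s) (hs : traceNorm A.1 ≤ ENNReal.ofReal s)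
    (hE : tensorEnergy b A.1 ≤ ENNReal.ofReal M * ENNReal.ofReal t) :
    idTensorTraceNorm Φ A ≤ ENNReal.ofReal s * ecDiamondNorm b M Φ := by
  have hfin : traceNorm A.1 ≠ ∞ := ne_of_lt A.2
  rcases le_total (ENNReal.ofReal t) (traceNorm A.1) with h | h
  · refine (idTensorTraceNorm_le_traceNorm_mul (M := M) (b := b) Φ hA (hE.trans ?_)).trans ?_
    · gcongr
    · gcongr
  set a : ℝ := (traceNorm A.1).toReal with ha
  have haA : traceNorm A.1 = ENNReal.ofReal a := (ENNReal.ofReal_toReal hfin).symm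
  have ha0 : 0 ≤ a := ENNReal.toReal_nonneg
  have hat : a ≤ t := by
    rw [haA] at h
    exact (ENNReal.ofReal_le_ofReal_iff ht).1 h
  -- The vacuum of the second factor must be paired with some unit vector of the reference factor.
  have hne : Nonempty (onbIndex H) := by
    by_contra hemp
    rw [not_nonempty_iff] at hemp
    have := eq_zero_of_forall_inner_eq_zero (onb H) (x := b 0) fun i => hemp.elim i
    simpa [this] using b.orthonormal.1 0
  obtain ⟨i⟩ := hne
  let v := tensorBasis (onb H) b
  let p := InnerProductSpace.rankOne ℂ (v (i, 0)) (v (i, 0))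
  have hp : p.IsPositive := InnerProductSpace.isPositive_rankOne_self _
  have hptr : traceNorm p = 1 := by
    rw [← weightedTrace_one v hp, weightedTrace_rankOne]
  have hpE : tensorEnergy b p = 0 := by
    refine (weightedTrace_rankOne v _ _).trans ?_
    simp
  -- The vacuum V of weight r fills the trace up to t without adding energy. Then A = (A + V) - V
  -- costs t + r ≤ 2t ≤ s.
  let r : ℝ := t - a
  have hr : 0 ≤ r := sub_nonneg.2 hat
  let V : TraceClass (HTensor H H) := (r : ℂ) • ⟨p, by
    change traceNorm p < ∞
    rw [hptr]
    exact ENNReal.one_lt_top⟩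
  have hV : V.1.IsPositive := hp.smul_of_nonneg (Complex.zero_le_real.2 hr)
  have hVtr : traceNorm V.1 = ENNReal.ofReal r := by
    change traceNorm ((r : ℂ) • p) = _
    rw [traceNorm_smul, hptr, mul_one, ← ofReal_norm, Complex.norm_of_nonneg hr]
  have hVE : tensorEnergy b V.1 = 0 := by
    refine (weightedTrace_smul _ _ p hr).trans ?_
    change _ * tensorEnergy b p = 0
    rw [hpE, mul_zero]
  have hsum : (A + V).1.IsPositive := hA.add hV
  have hsumtr : traceNorm (A + V).1 = ENNReal.ofReal t := by
    refine (traceNorm_add_of_isPositive hA hV).trans ?_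
    rw [hVtr, haA, ← ENNReal.ofReal_add ha0 hr]
    congr 1
    simp [r]
  have hsumE : tensorEnergy b (A + V).1 ≤ ENNReal.ofReal M * traceNorm (A + V).1 := by
    refine (weightedTrace_add _ _ hA hV).trans_le ?_
    change tensorEnergy b A.1 + tensorEnergy b V.1 ≤ _
    rwa [hVE, add_zero, hsumtr]
  have h1 := idTensorTraceNorm_le_traceNorm_mul Φ hsum hsumE
  have h2 := idTensorTraceNorm_le_traceNorm_mul (b := b) (M := M) Φ hV (by rw [hVE]; exact bot_le)
  rw [hsumtr] at h1
  rw [hVtr] at h2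
  calc idTensorTraceNorm Φ A = idTensorTraceNorm Φ (A + V - V) := by rw [add_sub_cancel_right]
    _ ≤ _ := idTensorTraceNorm_sub_le Φ _ _
    _ ≤ ENNReal.ofReal t * ecDiamondNorm b M Φ + ENNReal.ofReal r * ecDiamondNorm b M Φ :=
        add_le_add h1 h2
    _ = ENNReal.ofReal (t + r) * ecDiamondNorm b M Φ := by
        rw [← add_mul, ← ENNReal.ofReal_add ht hr]
    _ ≤ _ := by
        gcongr
        simp only [r]
        linarith

/-- `P` is the spectral projection `I ⊗ 1_{n̂ ≤ M}`. -/
def IsCutoff (b : HilbertBasis ℕ ℂ H) (M : ℝ) (P : HTensor H H →L[ℂ] HTensor H H) : Prop :=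
  ∀ k, P (tensorBasis (onb H) b k) =
    ((if (k.2 : ℝ) ≤ M then 1 else 0 : ℝ) : ℂ) • tensorBasis (onb H) b k

theorem exists_isCutoff (b : HilbertBasis ℕ ℂ H) (M : ℝ) : ∃ P, IsCutoff b M P := by
  classical
  exact exists_basis_projection (tensorBasis (onb H) b) {k | (k.2 : ℝ) ≤ M}

/-- The compression lives on levels n ≤ M, so its energy is at most M times its trace; A itself
needs no energy bound. -/
theorem IsCutoff.idTensorTraceNorm_conjTC_le {P : HTensor H H →L[ℂ] HTensor H H}
    (hP : IsCutoff b M P) {A : TraceClass (HTensor H H)} (hA : A.1.IsPositive) :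
    idTensorTraceNorm Φ (conjTC P A) ≤ traceNorm A.1 * ecDiamondNorm b M Φ := by
  have htr := traceNorm_conjTC (tensorBasis (onb H) b) hP hA
  refine (idTensorTraceNorm_le_traceNorm_mul (b := b) (M := M) Φ (isPositive_conjTC P hA) ?_).trans
    ?_
  · rw [htr, tensorEnergy, weightedTrace_conjTC _ _ hP, weightedTrace, weightedTrace,
      ← ENNReal.tsum_mul_left]
    refine ENNReal.tsum_le_tsum fun k => ?_
    rw [← mul_assoc]
    gcongr ?_ * _
    split_ifs with h
    · gcongr
      rw [← ENNReal.ofReal_natCast]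
      exact ENNReal.ofReal_le_ofReal h
    · simp
  · gcongr
    rw [htr]
    refine (weightedTrace_le_of_le (w := fun _ => 0) (α := 1) (β := 0) _ hA fun k => ?_).trans ?_
    · split_ifs <;> simp
    · simp

/-- An operator of trace one and energy at most `ε² M` is close to its compression to energies at
most `M`. -/
theorem IsCutoff.idTensorTraceNorm_sub_conjTC_le {E ε : ℝ} (hE : 0 < E) (hε : 0 < ε) (hε' : ε ≤ 1)
    {P : HTensor H H →L[ℂ] HTensor H H} (hP : IsCutoff b (E / ε ^ 2) P)
    {A : TraceClass (HTensor H H)} (hA : A.1.IsPositive) (htr : traceNorm A.1 = 1)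
    (hAE : tensorEnergy b A.1 ≤ ENNReal.ofReal E) :
    idTensorTraceNorm Φ (A - conjTC P A) ≤
      ENNReal.ofReal (4 * ε) * ecDiamondNorm b (E / ε ^ 2) Φ := by
  set N := ecDiamondNorm b (E / ε ^ 2) Φ
  set v := tensorBasis (onb H) b
  let w : onbIndex H × ℕ → ℝ≥0∞ := fun k => (k.2 : ℝ≥0∞)
  have hw : ∀ k, w k = ENNReal.ofReal (k.2 : ℝ) := fun k => (ENNReal.ofReal_natCast _).symm
  have key : ∀ (w' : onbIndex H × ℕ → ℝ≥0∞) (α β : ℝ), 0 ≤ α → 0 ≤ β →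
      (∀ k, w' k ≤ ENNReal.ofReal (α + β * k.2)) →
      weightedTrace v w' A.1 ≤ ENNReal.ofReal (α + β * E) := by
    intro w' α β hα hβ h
    refine (weightedTrace_le_of_le (w := w) (α := ENNReal.ofReal α) (β := ENNReal.ofReal β) v hA
      fun k => ?_).trans ?_
    · rw [hw, ← ENNReal.ofReal_mul hβ, ← ENNReal.ofReal_add hα (by positivity)]
      exact h k
    · rw [htr, mul_one, ENNReal.ofReal_add hα (by positivity), ENNReal.ofReal_mul hβ]
      gcongr
      exact hAE
  -- The bound on γ² by α + βn controls the trace by 2τ. The uniform bound τ/ε² controls the energy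
  -- by τE/ε² = τM, as the vacuum argument requires.
  have hbound : ∀ (D : HTensor H H →L[ℂ] HTensor H H) (γ : onbIndex H × ℕ → ℝ) (τ α β : ℝ),
      0 ≤ τ → 0 ≤ α → 0 ≤ β → (∀ k, D (v k) = (γ k : ℂ) • v k) →
      (∀ k, γ k ^ 2 ≤ α + β * k.2) → (∀ k, γ k ^ 2 ≤ τ / ε ^ 2) → α + β * E ≤ 2 * τ →
      idTensorTraceNorm Φ (conjTC D A) ≤ ENNReal.ofReal (2 * τ) * N := by
    intro D γ τ α β hτ hα hβ hD h1 h2 h3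
    refine idTensorTraceNorm_le_ofReal_mul Φ (isPositive_conjTC D hA) hτ le_rfl ?_ ?_
    · rw [traceNorm_conjTC v hD hA]
      exact (key _ α β hα hβ fun k => ENNReal.ofReal_le_ofReal (h1 k)).trans
        (ENNReal.ofReal_le_ofReal h3)
    · rw [tensorEnergy, weightedTrace_conjTC v _ hD]
      refine (key _ 0 (τ / ε ^ 2) le_rfl (by positivity) fun k => ?_).trans_eq ?_
      · rw [← ENNReal.ofReal_natCast, ← ENNReal.ofReal_mul (by positivity), zero_add, mul_comm]
        gcongr
        exact h2 k
      · rw [← ENNReal.ofReal_mul (by positivity)]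
        congr 1
        ring
  -- Markov's inequality on the levels above the cutoff.
  have htail : ∀ n : ℕ, ¬ (n : ℝ) ≤ E / ε ^ 2 → 1 ≤ ε ^ 2 / E * n := by
    intro n hn
    rw [not_le, div_lt_iff₀ (by positivity)] at hn
    rw [div_mul_eq_mul_div, le_div_iff₀ hE]
    linarith
  have hQ : ∀ k, (1 - P) (v k) = (((if (k.2 : ℝ) ≤ E / ε ^ 2 then 0 else 1 : ℝ)) : ℂ) • v k := by
    intro k
    rw [sub_apply, one_apply_eq_self, hP k]
    split_ifs <;> simp [v]
  have hsq : √ε ^ 2 = ε := Real.sq_sqrt hε.le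
  have hsq' : (√ε)⁻¹ ^ 2 = ε⁻¹ := by rw [inv_pow, hsq]
  have hεinv : ε ≤ ε⁻¹ := hε'.trans ((one_le_inv₀ hε).2 hε')
  have hεε : ε / ε ^ 2 = ε⁻¹ := by field_simp
  -- The weights √ε and 1/√ε balance the two parts of the trace: ε from P and ε⁻¹ · ε² = ε from 1 -
  -- P. The sign σ covers both compressions.
  have hoff : ∀ (σ : ℝ), σ ^ 2 = 1 → ∀ D : HTensor H H →L[ℂ] HTensor H H,
      D = ((√ε : ℝ) : ℂ) • P + ((σ * (√ε)⁻¹ : ℝ) : ℂ) • (1 - P) →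
      idTensorTraceNorm Φ (conjTC D A) ≤ ENNReal.ofReal (2 * ε) * N := by
    rintro σ hσ D rfl
    refine hbound _ (fun k => if (k.2 : ℝ) ≤ E / ε ^ 2 then √ε else σ * (√ε)⁻¹) ε ε (ε / E) hε.le
      hε.le (by positivity) (fun k => ?_) (fun k => ?_) (fun k => ?_) ?_
    · rw [add_apply, smul_apply, smul_apply, hP k, hQ k]
      split_ifs <;> simp [v]
    · split_ifs with h
      · rw [hsq]
        have : 0 ≤ ε / E * k.2 := by positivity
        linarith
      · rw [mul_pow, hσ, hsq', one_mul]
        have h1 := htail _ h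
        have h2 : ε⁻¹ ≤ ε⁻¹ * (ε ^ 2 / E * k.2) := le_mul_of_one_le_right (by positivity) h1
        have h3 : ε⁻¹ * (ε ^ 2 / E * k.2) = ε / E * k.2 := by field_simp
        linarith
    · rw [hεε]
      split_ifs with h
      · rw [hsq]; exact hεinv
      · rw [mul_pow, hσ, hsq', one_mul]
    · rw [div_mul_cancel₀ _ hE.ne']; linarith
  -- Here τ = ε²: the tail has trace at most ε² and energy at most E = ε²M.
  have hQA : idTensorTraceNorm Φ (conjTC (1 - P) A) ≤ ENNReal.ofReal (2 * ε ^ 2) * N := by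
    refine hbound _ _ (ε ^ 2) 0 (ε ^ 2 / E) (by positivity) le_rfl (by positivity) hQ
      (fun k => ?_) (fun k => ?_) ?_
    · split_ifs with h
      · have : 0 ≤ ε ^ 2 / E * k.2 := by positivity
        simpa using this
      · simpa using htail _ h
    · rw [div_self (by positivity)]
      split_ifs <;> simp
    · rw [div_mul_cancel₀ _ hE.ne']
      have : 0 ≤ ε ^ 2 := by positivity
      linarith
  have hplus := hoff 1 (by norm_num) (((√ε : ℝ) : ℂ) • P + (((√ε)⁻¹ : ℝ) : ℂ) • (1 - P))
    (by rw [one_mul])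
  have hminus := hoff (-1) (by norm_num) (((√ε : ℝ) : ℂ) • P - (((√ε)⁻¹ : ℝ) : ℂ) • (1 - P))
    (by rw [neg_one_mul, Complex.ofReal_neg, neg_smul, sub_eq_add_neg])
  rw [sub_conjTC_eq P (mul_inv_cancel₀ (Real.sqrt_pos.2 hε).ne') A]
  refine (idTensorTraceNorm_add_le Φ _ _).trans ?_
  refine (add_le_add (idTensorTraceNorm_smul_le Φ (by norm_num) _) hQA).trans ?_
  have hhalf : ‖(2⁻¹ : ℂ)‖ₑ = ENNReal.ofReal 2⁻¹ := by
    rw [← ofReal_norm]; norm_num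
  calc _ ≤ ENNReal.ofReal 2⁻¹ * (ENNReal.ofReal (2 * ε) * N + ENNReal.ofReal (2 * ε) * N) +
        ENNReal.ofReal (2 * ε ^ 2) * N := by
        rw [hhalf]
        gcongr
        exact (idTensorTraceNorm_sub_le Φ _ _).trans (add_le_add hplus hminus)
    _ = ENNReal.ofReal (2⁻¹ * (2 * ε + 2 * ε) + 2 * ε ^ 2) * N := by
        rw [← add_mul, ← mul_assoc, ← add_mul, ← ENNReal.ofReal_add (by positivity) (by positivity),
          ← ENNReal.ofReal_mul (by positivity),
          ← ENNReal.ofReal_add (by positivity) (by positivity)]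
    _ ≤ _ := by
        gcongr
        nlinarith

/-- The compressed part is written through B and C, whose traces are small, and the remainder
through X and Y, whose energies are bounded. -/
theorem sub_eq_conjTC_add {W : Type*} [NormedAddCommGroup W] [InnerProductSpace ℂ W]
    [CompleteSpace W] (P : W →L[ℂ] W) {X Y B C : TraceClass W} (h : X - Y = B - C) :
    X - Y = (conjTC P B - conjTC P C) + ((X - conjTC P X) - (Y - conjTC P Y)) := by
  rw [← conjTC_sub, ← h, conjTC_sub]
  abel

/-- Two states of energy at most `ε² M` that are `2 ε`-close in trace norm remain close after
applying `Φ`, relative to the norm of `Φ` at energy `M`. -/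
theorem idTensorTraceNorm_sub_le_of_traceNorm_le {E ε : ℝ} (hE : 0 < E) (hε : 0 < ε)
    (hε' : ε ≤ 1) {X Y : TraceClass (HTensor H H)} (hX : X.1.IsPositive) (hY : Y.1.IsPositive)
    (hXtr : traceNorm X.1 = 1) (hYtr : traceNorm Y.1 = 1)
    (hXE : tensorEnergy b X.1 ≤ ENNReal.ofReal E) (hYE : tensorEnergy b Y.1 ≤ ENNReal.ofReal E)
    (hXY : traceNorm (X.1 - Y.1) ≤ ENNReal.ofReal (2 * ε)) :
    idTensorTraceNorm Φ (X - Y) ≤ ENNReal.ofReal (10 * ε) * ecDiamondNorm b (E / ε ^ 2) Φ := by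
  obtain ⟨P, hP⟩ := exists_isCutoff b (E / ε ^ 2)
  obtain ⟨B, C, hB, hC, hBC, hBCtr⟩ :=
    exists_jordan_decomposition (hX.isSelfAdjoint.sub hY.isSelfAdjoint)
  have hfin : traceNorm B + traceNorm C < ∞ := by
    rw [hBCtr]; exact hXY.trans_lt ENNReal.ofReal_lt_top
  obtain ⟨B', rfl⟩ : ∃ B' : TraceClass (HTensor H H), B'.1 = B :=
    ⟨⟨B, (ENNReal.add_lt_top.1 hfin).1⟩, rfl⟩
  obtain ⟨C', rfl⟩ : ∃ C' : TraceClass (HTensor H H), C'.1 = C :=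
    ⟨⟨C, (ENNReal.add_lt_top.1 hfin).2⟩, rfl⟩
  rw [sub_eq_conjTC_add P (show X - Y = B' - C' from Subtype.ext hBC)]
  have h1 := hP.idTensorTraceNorm_conjTC_le Φ hB
  have h2 := hP.idTensorTraceNorm_conjTC_le Φ hC
  have h3 := hP.idTensorTraceNorm_sub_conjTC_le Φ hE hε hε' hX hXtr hXE
  have h4 := hP.idTensorTraceNorm_sub_conjTC_le Φ hE hε hε' hY hYtr hYE
  set N := ecDiamondNorm b (E / ε ^ 2) Φ
  refine (idTensorTraceNorm_add_le Φ _ _).trans ((add_le_add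
    ((idTensorTraceNorm_sub_le Φ _ _).trans (add_le_add h1 h2))
    ((idTensorTraceNorm_sub_le Φ _ _).trans (add_le_add h3 h4))).trans ?_)
  rw [← add_mul, hBCtr]
  calc _ ≤ ENNReal.ofReal (2 * ε) * N +
        (ENNReal.ofReal (4 * ε) * N + ENNReal.ofReal (4 * ε) * N) := by gcongr
    _ = ENNReal.ofReal (10 * ε) * N := by
        rw [← add_mul, ← add_mul, ← ENNReal.ofReal_add (by positivity) (by positivity),
          ← ENNReal.ofReal_add (by positivity) (by positivity)]
        congr 2
        ring

/-- The output `(Id ⊗ Ψ)(ρ)` of an energy-limited channel. -/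
theorem IsCPTP.exists_output {E₁ E₂ : ℝ} {Ψ : TraceClass H →ₗ[ℂ] TraceClass H} (hΨ : IsCPTP Ψ)
    (hΨE : MapsEnergyStates b E₁ E₂ Ψ) {ρ : TraceClass (HTensor H H)} (hρ : IsDensity ρ.1)
    (hρE : partialTrace ρ.1 ∈ energyStates b E₁) :
    ∃ X : TraceClass (HTensor H H), X.1.IsPositive ∧ IsIdTensor Ψ ρ X.1 ∧ traceNorm X.1 = 1 ∧
      tensorEnergy b X.1 ≤ ENNReal.ofReal E₂ := by
  obtain ⟨hpos, htr⟩ := isDensity_iff.1 hρ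
  obtain ⟨X, hX, hblock⟩ := hΨ.exists_idTensor hpos
  have hdiag : ∀ f, ((blockTC ρ f f : TraceClass H) : H →L[ℂ] H).IsPositive := fun f =>
    isPositive_block hpos f
  have hXtr : traceNorm X = 1 := by
    rw [traceNorm_eq_tsum_block (onb H) hX, ← htr, traceNorm_eq_tsum_block (onb H) hpos]
    refine tsum_congr fun i => ?_
    rw [hblock, hΨ.traceNorm_eq (hdiag _)]
    rfl
  refine ⟨⟨X, (hXtr.trans_lt ENNReal.one_lt_top : traceNorm X < ∞)⟩, hX, hblock, hXtr, ?_⟩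
  let σ : TraceClass H := ⟨partialTrace ρ.1, hρE.1.2.1⟩
  have hσ := (hΨE σ hρE).2
  change weightedTrace _ _ X ≤ _
  rw [weightedTrace_tensorBasis (onb H) b (fun n => (n : ℝ≥0∞)) X]
  rw [ENNReal.tsum_eq_iSup_sum]
  refine iSup_le fun s => ?_
  have hsum : ∀ s : Finset (onbIndex H),
      ∑ i ∈ s, weightedTrace b (fun n => (n : ℝ≥0∞)) (block X (onb H i) (onb H i)) =
        weightedTrace b (fun n => (n : ℝ≥0∞))
          (∑ i ∈ s, block X (onb H i) (onb H i)) := by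
    classical
    intro s
    induction s using Finset.induction_on with
    | empty => simp [weightedTrace]
    | insert i s hi ih =>
      rw [Finset.sum_insert hi, Finset.sum_insert hi, ih, weightedTrace_add _ _
        (isPositive_block hX _) (ContinuousLinearMap.isPositive_sum s fun j _ =>
          isPositive_block hX _)]
  rw [hsum]
  refine le_trans (weightedTrace_mono b _ ?_) hσ
  -- Linearity over the finite set s is enough: the remainder σ - ∑ₛ is positive, so its image is,
  -- and each partial sum has energy at most that of Ψ σ.
  have h1 : (Ψ σ : H →L[ℂ] H) - ∑ i ∈ s, block X (onb H i) (onb H i) =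
      (Ψ (σ - ∑ i ∈ s, blockTC ρ (onb H i) (onb H i)) : H →L[ℂ] H) := by
    rw [map_sub, map_sum, Submodule.coe_sub, Submodule.coe_sum]
    simp_rw [hblock _ _]
  rw [h1]
  refine hΨ.1.isPositive ?_
  rw [Submodule.coe_sub, Submodule.coe_sum]
  exact isPositive_sub_of_hasSum (fun i => hdiag (onb H i))
    (hasSum_partialTrace hpos (ne_of_lt ρ.2)) s

end EnergyBounds

end ECDiamond

end

/-! ### The main estimate -/

theorem mainTheorem4 {H : Type*} [NormedAddCommGroup H] [InnerProductSpace ℂ H] [CompleteSpace H]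
    (b : HilbertBasis ℕ ℂ H) (E₁ E₂ ε : ℝ) (hE₁ : 0 < E₁) (hE₂ : 0 < E₂)
    (hε : 0 < ε) (hε' : ε ≤ 1)
    (Ψ Ψt : ECDiamond.TraceClass H →ₗ[ℂ] ECDiamond.TraceClass H)
    (hΨ : ECDiamond.IsCPTP Ψ) (hΨt : ECDiamond.IsCPTP Ψt)
    (hΨE : ECDiamond.MapsEnergyStates b E₁ E₂ Ψ) (hΨtE : ECDiamond.MapsEnergyStates b E₁ E₂ Ψt)
    (hdist : ECDiamond.ecDiamondNorm b E₁ (Ψ - Ψt) ≤ ENNReal.ofReal (2 * ε))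
    (Φ : ECDiamond.TraceClass H →ₗ[ℂ] ECDiamond.TraceClass H)
    (hΦ : ECDiamond.IsHermitianPreserving Φ) :
    ECDiamond.ecDiamondNorm b E₁ (Φ ∘ₗ (Ψ - Ψt)) ≤
      ENNReal.ofReal (10 * ε) * ECDiamond.ecDiamondNorm b (E₂ / ε ^ 2) Φ := by
  refine iSup₂_le fun ρ hρ => iSup_le fun hρE => ?_
  obtain ⟨X, hX, hXΨ, hXtr, hXE⟩ := hΨ.exists_output hΨE hρ hρE
  obtain ⟨Y, hY, hYΨ, hYtr, hYE⟩ := hΨt.exists_output hΨtE hρ hρE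
  have hXY : ECDiamond.IsIdTensor (Ψ - Ψt) ρ (X.1 - Y.1) := hXΨ.sub hYΨ
  refine (ECDiamond.idTensorTraceNorm_comp_le (Y := X - Y) Φ (Ψ - Ψt) hXY).trans ?_
  refine ECDiamond.idTensorTraceNorm_sub_le_of_traceNorm_le Φ hE₂ hε hε' hX hY hXtr hYtr hXE hYE ?_
  -- X - Y is the output of Ψ - Ψt at ρ, so its trace norm is one of the terms bounded by `hdist`.
  rw [← ECDiamond.idTensorTraceNorm_eq _ hXY]
  exact (ECDiamond.idTensorTraceNorm_le_ecDiamondNorm _ hρ hρE).trans hdist
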